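/- Let $R$ be a commutative ring. For partitions $\mu\subseteq\lambda$ and a totally ordered set of variables $X$ (finite, or infinite, such as $x_1,x_2,\dots$, for an identity of symmetric functions), let $S_{\lambda/\mu}(X)=\sum_T x^T$ be the skew Schur function with coefficients in $R$, the sum being over all semistandard tableaux $T$ of shape $\lambda/\mu$ with entries in the index set of $X$, and let $S_\lambda=S_{\lambda/\varnothing}$. Let $\lambda'$ be the conjugate of $\lambda$ and $(\lambda/\mu)'=\lambda'/\mu'$. The doubly Schur function is $$DS_\lambda=\sum_{\mu\subseteq\lambda}S_\mu\,S_{(\lambda/\mu)'}.$$ For $n\ge 1$ let $k_n=\sum_{a+b=n,\ a\ge 1}S_{(a,1^b)}$, and let $f^\lambda$ be the number of standard Young tableaux of shape $\lambda$. Then the following hold. (1) For every partition $\lambda$ and every integer $N\ge 0$ that is at least the number of parts of $\lambda$, $$DS_\lambda=\det\left(2k_{\lambda_i-i+j}\right)_{1\le i,j\le N},$$ where $\lambda_i=0$ beyond the last part, and where the entry $2k_m$ is read as $1$ if $m=0$ and as $0$ if $m<0$. (2) For all integers $n,k\ge 0$, $$\sum_{\lambda\vdash n}f^\lambda\,DS_\lambda(x_1,\dots,x_k)=2^n(x_1+\cdots+x_k)^n.$$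 (3) For all finite sets of variables $X=\{x_1,\dots,x_a\}$ and $Y=\{y_1,\dots,y_b\}$ (with $a,b\ge 0$), $$\sum_\lambda DS_\lambda(X)\,DS_\lambda(Y)=\prod_{i=1}^a\prod_{j=1}^b\frac{(1+x_iy_j)^2}{(1-x_iy_j)^2} \qquad\text{and}\qquad \sum_\lambda DS_\lambda(X)\,S_\lambda(Y)=\prod_{i=1}^a\prod_{j=1}^b\frac{1+x_iy_j}{1-x_iy_j},$$ as identities of formal power series over $R$, where the sums are over all partitions $\lambda$ and converge coefficientwise (each coefficient is a finite sum). -/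

import Mathlib

open scoped MvPowerSeries.WithPiTopology

noncomputable section

namespace DoublySchur

/-- Partitions are encoded by Young diagrams in English notation: the part `λ_{i+1}` is
`lam.rowLen i`, the conjugate `λ'` is `lam.transpose`, and `|λ|` is `lam.card`.
For `mu ≤ lam`, a semistandard tableau of skew shape `lam/mu` with entries in the ordered
alphabet `σ`: a filling of the cells of `lam` outside `mu` that is weakly increasing along
rows and strictly increasing down columns. A cell `(i, j)` is in row `i` and column `j`. -/
structure SkewTableau (lam mu : YoungDiagram) (σ : Type*) [LinearOrder σ] where
  /-- The entries. -/
  entry : {c : ℕ × ℕ // c ∈ lam.cells \ mu.cells} → σ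
  row_weak : ∀ c c', c.1.1 = c'.1.1 → c.1.2 < c'.1.2 → entry c ≤ entry c'
  col_strict : ∀ c c', c.1.2 = c'.1.2 → c.1.1 < c'.1.1 → entry c < entry c'

/-- The content of a tableau: the exponent vector of the monomial `x^T`. -/
def SkewTableau.content {lam mu : YoungDiagram} {σ : Type*} [LinearOrder σ]
    (T : SkewTableau lam mu σ) : σ →₀ ℕ :=
  ∑ c, Finsupp.single (T.entry c) 1

/-- The skew Schur function `S_{lam/mu}` in the variables indexed by `σ`, that is `∑_T x^T`
over the semistandard tableaux of shape `lam/mu`: the coefficient at `d` is the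
(finite) number of tableaux of content `d`. For `σ = ℕ` this is the symmetric function in
infinitely many variables, for `σ = Fin k` it is the symmetric polynomial
in `k` variables. -/
def skewSchur (R : Type*) [CommRing R] (σ : Type*) [LinearOrder σ] (lam mu : YoungDiagram) :
    MvPowerSeries σ R :=
  fun d => (Nat.card {T : SkewTableau lam mu σ // T.content = d} : R)

/-- The Schur function `S_lam`. -/
def schur (R : Type*) [CommRing R] (σ : Type*) [LinearOrder σ] (lam : YoungDiagram) :
    MvPowerSeries σ R :=
  skewSchur R σ lam ⊥

theorem cells_injective : Function.Injective YoungDiagram.cells :=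
  fun _ _ h => YoungDiagram.ext h

theorem finite_le (lam : YoungDiagram) : {mu : YoungDiagram | mu ≤ lam}.Finite := by
  refine Set.Finite.of_finite_image (f := YoungDiagram.cells) ?_ cells_injective.injOn
  refine (lam.cells.powerset.finite_toSet).subset ?_
  rintro _ ⟨mu, h, rfl⟩
  simpa using h

theorem finite_card_eq (n : ℕ) : {lam : YoungDiagram | lam.card = n}.Finite := by
  refine Set.Finite.of_finite_image (f := YoungDiagram.cells) ?_ cells_injective.injOn
  refine ((Finset.range n ×ˢ Finset.range n).powerset.finite_toSet).subset ?_
  rintro _ ⟨lam, rfl, rfl⟩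
  simp only [Finset.coe_powerset, Set.mem_preimage, Set.mem_powerset_iff, Finset.coe_subset]
  rintro ⟨i, j⟩ h
  rw [YoungDiagram.mem_cells] at h
  have h1 : (lam.row i).card ≤ lam.card := Finset.card_le_card (Finset.filter_subset _ _)
  have h2 : (lam.col j).card ≤ lam.card := Finset.card_le_card (Finset.filter_subset _ _)
  rw [← YoungDiagram.rowLen_eq_card] at h1
  rw [← YoungDiagram.colLen_eq_card] at h2
  have h3 := YoungDiagram.mem_iff_lt_rowLen.1 h
  have h4 := YoungDiagram.mem_iff_lt_colLen.1 h
  simp only [Finset.mem_product, Finset.mem_range]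
  omega

/-- The partitions contained in `lam`. -/
def subdiagrams (lam : YoungDiagram) : Finset YoungDiagram := (finite_le lam).toFinset

/-- The partitions of `n`. -/
def partitionsOf (n : ℕ) : Finset YoungDiagram := (finite_card_eq n).toFinset

/-- The doubly Schur function `DS_lam = ∑_{mu ⊆ lam} S_mu S_{(lam/mu)'}`, where the conjugate
of the skew shape `lam/mu` is `lam'/mu'`. -/
def doublySchur (R : Type*) [CommRing R] (σ : Type*) [LinearOrder σ] (lam : YoungDiagram) :
    MvPowerSeries σ R :=
  ∑ mu ∈ subdiagrams lam, schur R σ mu * skewSchur R σ lam.transpose mu.transpose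

/-- The hook partition `(a, 1^b)`, for `1 ≤ a`: a first row of `a` cells and
`b` further cells below its first cell. -/
def hook (a b : ℕ) : YoungDiagram where
  cells := (Finset.range (b + 1) ×ˢ Finset.range a).filter fun c => c.1 = 0 ∨ c.2 = 0
  isLowerSet := by
    rintro ⟨i, j⟩ ⟨i', j'⟩ h hc
    obtain ⟨h1, h2⟩ := Prod.mk_le_mk.1 h
    simp only [Finset.coe_filter, Finset.mem_product, Finset.mem_range, Set.mem_ofPred_eq] at hc ⊢
    omega

/-- `k_n = ∑_{a+b=n} S_{(a,1^b)}`, the sum being over all the hook partitions of `n`. -/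
def hookSum (R : Type*) [CommRing R] (σ : Type*) [LinearOrder σ] (n : ℕ) : MvPowerSeries σ R :=
  ∑ p ∈ (Finset.HasAntidiagonal.antidiagonal n).filter fun p => 1 ≤ p.1, schur R σ (hook p.1 p.2)

/-- The determinant entry written `2 k_m`, for an integer `m`, with the usual conventions
that it is `1` for `m = 0` and `0` for `m < 0`. -/
def twoK (R : Type*) [CommRing R] (σ : Type*) [LinearOrder σ] (m : ℤ) : MvPowerSeries σ R :=
  if m < 0 then 0 else if m = 0 then 1 else 2 * hookSum R σ m.toNat

/-- A standard Young tableau of shape `lam`: a bijective filling by `|lam|` labels,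
strictly increasing along rows and down columns. -/
structure StandardTableau (lam : YoungDiagram) where
  /-- The entries. -/
  entry : {c : ℕ × ℕ // c ∈ lam.cells} → Fin lam.card
  bijective : Function.Bijective entry
  row_strict : ∀ c c', c.1.1 = c'.1.1 → c.1.2 < c'.1.2 → entry c < entry c'
  col_strict : ∀ c c', c.1.2 = c'.1.2 → c.1.1 < c'.1.1 → entry c < entry c'

/-- `f^lam`, the number of standard Young tableaux of shape `lam`. -/
def numStandard (lam : YoungDiagram) : ℕ := Nat.card (StandardTableau lam)

/-- The variable `x_i` among the two disjoint families `x_1, …, x_a` and `y_1, …, y_b`. -/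
def xVar (R : Type*) [CommRing R] (a b : ℕ) (i : Fin a) : MvPowerSeries (Fin a ⊕ Fin b) R :=
  MvPowerSeries.X (Sum.inl i)

/-- The variable `y_j`. -/
def yVar (R : Type*) [CommRing R] (a b : ℕ) (j : Fin b) : MvPowerSeries (Fin a ⊕ Fin b) R :=
  MvPowerSeries.X (Sum.inr j)

/-- `f(X)` as a power series in the two families of variables. -/
def inX {R : Type*} [CommRing R] {a : ℕ} (b : ℕ) (f : MvPowerSeries (Fin a) R) :
    MvPowerSeries (Fin a ⊕ Fin b) R :=
  MvPowerSeries.rename Sum.inl f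

/-- `f(Y)` as a power series in the two families of variables. -/
def inY {R : Type*} [CommRing R] (a : ℕ) {b : ℕ} (f : MvPowerSeries (Fin b) R) :
    MvPowerSeries (Fin a ⊕ Fin b) R :=
  MvPowerSeries.rename Sum.inr f

/-- The power series `(1 + x_i y_j) / (1 - x_i y_j)`; the second factor is the inverse of
`1 - x_i y_j`, whose constant coefficient is `1`. -/
def cauchyFactor (R : Type*) [CommRing R] (a b : ℕ) (i : Fin a) (j : Fin b) :
    MvPowerSeries (Fin a ⊕ Fin b) R :=
  (1 + xVar R a b i * yVar R a b j) *
    MvPowerSeries.invOfUnit (1 - xVar R a b i * yVar R a b j) 1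

end DoublySchur

end

noncomputable section

namespace DoublySchur

/-! ### Horizontal strips -/

/-! In finitely many variables everything is read off the series `H(t) E(t) = ∏ (1 + x_i t) / (1 -
x_i t)`. To a power series `f` with constant term 1 attach the determinants `jacobiTrudi f lam`,
with entries `f_{lam_i - i + j}`. Multiplying `f` by `1 / (1 - y t)` expands these along horizontal
strips (`jacobiTrudi_hStrip`), and multiplying by `1 + y t` expands them along vertical strips
(`jacobiTrudi_vStrip`). These are the branching rules of skew tableaux and of their conjugates.
Adjoining the variables one at a time therefore expands the determinants of `f H` and `f E` in skew
Schur polynomials; `f = 1` gives both Jacobi–Trudi identities, and `f = H` shows that `DS_lam` is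
the determinant of `H E`. The coefficients of `H E` are the `2 k_n`, because `h_a e_b` is a sum of
two hook Schur functions. The determinant formula passes to arbitrary alphabets because a power
series is determined by its restrictions to finite sets of variables.

The determinants of any such `f` also satisfy Pieri's rule (`sum_jacobiTrudi_hStrip`). Iterating it
with strips of one cell builds standard tableaux and gives `∑ f^lam DS_lam = f_1 ^ n`, where `f_1 =
2 ∑ x_i` for `f = H E`.

For the Cauchy identities, adjoin the variables `y_j` to the second factor: branching on that side
and Pieri on the other make each `y_j` contribute a factor `f(y_j t)` (`cauchySeries_strip`).
Adjoining `y_j` as an elementary variable needs Pieri for vertical strips, which follows from the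
horizontal rule because `DS_lam` is invariant under conjugating `lam`. Thus `S_lam(Y)` yields the
product once and `DS_lam(Y)` yields it twice, hence the square. The auxiliary variable `t` records
the degree in `X`, which turns the infinite sums into finite ones. -/

/-- `lam/nu` is a horizontal strip: `nu ≤ lam`, and no two cells of `lam` outside `nu` lie in the
same column. -/
def HStrip (nu lam : YoungDiagram) : Prop :=
  nu ≤ lam ∧ ∀ i j, (i + 1, j) ∈ lam → (i, j) ∈ nu

theorem mem_subdiagrams {lam mu : YoungDiagram} : mu ∈ subdiagrams lam ↔ mu ≤ lam := by
  simp [subdiagrams]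

theorem mem_partitionsOf {n : ℕ} {lam : YoungDiagram} : lam ∈ partitionsOf n ↔ lam.card = n := by
  simp [partitionsOf]

/-! ### Tableaux and their weights -/

section Tableaux

variable {lam mu nu : YoungDiagram} {σ : Type*} [LinearOrder σ]

theorem SkewTableau.entry_injective :
    Function.Injective (SkewTableau.entry : SkewTableau lam mu σ → _) := by
  rintro ⟨e, _, _⟩ ⟨e', _, _⟩ h
  cases h
  rfl

instance [Finite σ] : Finite (SkewTableau lam mu σ) :=
  Finite.of_injective _ SkewTableau.entry_injective

instance [Fintype σ] : Fintype (SkewTableau lam mu σ) := Fintype.ofFinite _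

/-- The value `x^T` of the monomial of a tableau at a family `x` of elements of a monoid. -/
def SkewTableau.weight {M : Type*} [CommMonoid M] (x : σ → M) (T : SkewTableau lam mu σ) : M :=
  ∏ c, x (T.entry c)

/-- Entries increase weakly from a cell to a cell to its lower right. -/
theorem SkewTableau.entry_le (T : SkewTableau lam mu σ)
    {c c' : {c : ℕ × ℕ // c ∈ lam.cells \ mu.cells}} (h : c.1 ≤ c'.1) :
    T.entry c ≤ T.entry c' := by
  obtain ⟨⟨i, j⟩, hc⟩ := c
  obtain ⟨⟨i', j'⟩, hc'⟩ := c'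
  obtain ⟨hi, hj⟩ := Prod.mk_le_mk.1 h
  -- The corner `(i, j')` is above `c'`, hence in `lam`, and to the right of `c`, hence outside
  -- `mu`; the path from `c` to `c'` turns there.
  have hm : (i, j') ∈ lam.cells \ mu.cells := by
    simp only [Finset.mem_sdiff, YoungDiagram.mem_cells] at hc hc' ⊢
    exact ⟨lam.up_left_mem hi le_rfl hc'.1, fun h' => hc.2 (mu.up_left_mem le_rfl hj h')⟩
  calc T.entry ⟨(i, j), hc⟩ ≤ T.entry ⟨(i, j'), hm⟩ := by
        rcases hj.eq_or_lt with rfl | hj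
        · exact le_rfl
        · exact T.row_weak _ _ rfl hj
    _ ≤ T.entry ⟨(i', j'), hc'⟩ := by
        rcases hi.eq_or_lt with rfl | hi
        · exact le_rfl
        · exact (T.col_strict ⟨(i, j'), hm⟩ ⟨(i', j'), hc'⟩ rfl hi).le

variable {k : ℕ}

/-- The diagram formed by `mu` and the cells of a tableau with an entry other than the largest
letter. -/
def SkewTableau.innerShape (T : SkewTableau lam mu (Fin (k + 1))) :
    YoungDiagram where
  cells := lam.cells.filter fun c => ∀ h : c ∈ lam.cells \ mu.cells, T.entry ⟨c, h⟩ ≠ Fin.last k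
  isLowerSet := by
    intro c c' hle hc
    simp only [Finset.coe_filter, Set.mem_ofPred_eq, YoungDiagram.mem_cells] at hc ⊢
    have hc' : c' ∈ lam := lam.isLowerSet hle hc.1
    refine ⟨hc', fun h heq => ?_⟩
    have hcm : c ∈ lam.cells \ mu.cells := by
      simp only [Finset.mem_sdiff, YoungDiagram.mem_cells] at h ⊢
      exact ⟨hc.1, fun h' => h.2 (mu.isLowerSet hle h')⟩
    refine hc.2 hcm (le_antisymm (Fin.le_last _) ?_)
    rw [← heq]
    exact T.entry_le hle

theorem SkewTableau.mem_innerShape {T : SkewTableau lam mu (Fin (k + 1))}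
    {c : ℕ × ℕ} : c ∈ T.innerShape ↔
      c ∈ lam ∧ ∀ h : c ∈ lam.cells \ mu.cells, T.entry ⟨c, h⟩ ≠ Fin.last k := by
  simp [SkewTableau.innerShape]

theorem SkewTableau.innerShape_le (T : SkewTableau lam mu (Fin (k + 1))) :
    T.innerShape ≤ lam := fun _ hc => (mem_innerShape.1 hc).1

theorem SkewTableau.le_innerShape (T : SkewTableau lam mu (Fin (k + 1))) (hmu : mu ≤ lam) :
    mu ≤ T.innerShape := fun c hc =>
  mem_innerShape.2 ⟨hmu hc, fun h => by
    simp only [Finset.mem_sdiff, YoungDiagram.mem_cells] at h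
    exact absurd hc h.2⟩

/-- Columns are strict, so nothing can lie below a cell that carries the largest letter. -/
theorem SkewTableau.hStrip_innerShape (T : SkewTableau lam mu (Fin (k + 1))) :
    HStrip T.innerShape lam := by
  refine ⟨T.innerShape_le, fun i j h => ?_⟩
  refine mem_innerShape.2 ⟨lam.up_left_mem (Nat.le_succ i) le_rfl h, fun h' heq => ?_⟩
  have h'' : (i + 1, j) ∈ lam.cells \ mu.cells := by
    simp only [Finset.mem_sdiff, YoungDiagram.mem_cells] at h' ⊢
    exact ⟨h, fun hm => h'.2 (mu.up_left_mem (Nat.le_succ i) le_rfl hm)⟩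
  have := T.col_strict ⟨_, h'⟩ ⟨_, h''⟩ rfl (Nat.lt_succ_self i)
  rw [heq] at this
  exact absurd (Fin.le_last _) this.not_ge

/-- The entries of the tableau obtained from one of shape `nu/mu` by filling the cells of `lam`
outside `nu` with a new largest letter. -/
def SkewTableau.extendEntry (T : SkewTableau nu mu (Fin k)) (c : ℕ × ℕ) : Fin (k + 1) :=
  if h : c ∈ nu.cells \ mu.cells then (T.entry ⟨c, h⟩).castSucc else Fin.last k

theorem SkewTableau.extendEntry_of_mem (T : SkewTableau nu mu (Fin k)) {c : ℕ × ℕ}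
    (h : c ∈ nu.cells \ mu.cells) : T.extendEntry c = (T.entry ⟨c, h⟩).castSucc := dif_pos h

theorem SkewTableau.extendEntry_of_notMem (T : SkewTableau nu mu (Fin k)) {c : ℕ × ℕ}
    (h : c ∉ nu.cells \ mu.cells) : T.extendEntry c = Fin.last k := dif_neg h

/-- Filling the cells of a horizontal strip `lam/nu` with a new largest letter. -/
def SkewTableau.extend (hs : HStrip nu lam) (T : SkewTableau nu mu (Fin k)) :
    SkewTableau lam mu (Fin (k + 1)) where
  entry c := T.extendEntry c.1
  row_weak := by
    rintro ⟨⟨i, j⟩, hc⟩ ⟨⟨i', j'⟩, hc'⟩ (rfl : i = i') (hj : j < j')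
    by_cases h' : (i, j') ∈ nu.cells \ mu.cells
    · have h : (i, j) ∈ nu.cells \ mu.cells := by
        simp only [Finset.mem_sdiff, YoungDiagram.mem_cells] at hc h' ⊢
        exact ⟨nu.up_left_mem le_rfl hj.le h'.1, hc.2⟩
      rw [T.extendEntry_of_mem h, T.extendEntry_of_mem h']
      exact Fin.castSucc_le_castSucc_iff.2 (T.row_weak _ _ rfl hj)
    · rw [T.extendEntry_of_notMem h']
      exact Fin.le_last _
  col_strict := by
    rintro ⟨⟨i, j⟩, hc⟩ ⟨⟨i', j'⟩, hc'⟩ (rfl : j = j') (hi : i < i')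
    -- In a horizontal strip only the lowest cell of a column can be new, so the upper of the two
    -- cells carries an old letter.
    have h : (i, j) ∈ nu.cells \ mu.cells := by
      simp only [Finset.mem_sdiff, YoungDiagram.mem_cells] at hc hc' ⊢
      exact ⟨hs.2 i j (lam.up_left_mem hi le_rfl hc'.1), hc.2⟩
    rw [T.extendEntry_of_mem h]
    by_cases h' : (i', j) ∈ nu.cells \ mu.cells
    · rw [T.extendEntry_of_mem h']
      exact Fin.castSucc_lt_castSucc_iff.2 (T.col_strict _ _ rfl hi)
    · rw [T.extendEntry_of_notMem h']
      exact Fin.castSucc_lt_last _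

theorem SkewTableau.extend_injective (hs : HStrip nu lam) :
    Function.Injective (SkewTableau.extend (mu := mu) (k := k) hs) := by
  intro T T' h
  apply SkewTableau.entry_injective
  funext ⟨c, hc⟩
  have hc' : c ∈ lam.cells \ mu.cells := by
    simp only [Finset.mem_sdiff, YoungDiagram.mem_cells] at hc ⊢
    exact ⟨hs.1 hc.1, hc.2⟩
  have := congrFun (congrArg SkewTableau.entry h) ⟨c, hc'⟩
  simp only [SkewTableau.extend, extendEntry_of_mem _ hc] at this
  exact Fin.castSucc_injective _ this

theorem SkewTableau.innerShape_extend (hs : HStrip nu lam) (hmn : mu ≤ nu)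
    (T : SkewTableau nu mu (Fin k)) : (T.extend hs).innerShape = nu := by
  apply SetLike.ext
  intro c
  rw [mem_innerShape]
  constructor
  · rintro ⟨h1, h2⟩
    by_contra hn
    refine h2 ?_ ?_
    · simp only [Finset.mem_sdiff, YoungDiagram.mem_cells]
      exact ⟨h1, fun h => hn (hmn h)⟩
    · refine T.extendEntry_of_notMem ?_
      simp [hn]
  · intro hc
    refine ⟨hs.1 hc, fun h => ?_⟩
    have h' : c ∈ nu.cells \ mu.cells := by
      simp only [Finset.mem_sdiff, YoungDiagram.mem_cells] at h ⊢
      exact ⟨hc, h.2⟩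
    simp only [SkewTableau.extend, T.extendEntry_of_mem h']
    exact (Fin.castSucc_lt_last _).ne

/-- The cells of a tableau with an entry other than the largest letter. -/
def SkewTableau.restrict (T : SkewTableau lam mu (Fin (k + 1))) :
    SkewTableau T.innerShape mu (Fin k) where
  entry c := (T.entry ⟨c.1, Finset.sdiff_subset_sdiff T.innerShape_le le_rfl c.2⟩).castPred
    ((mem_innerShape.1 (Finset.mem_sdiff.1 c.2).1).2 _)
  row_weak _ _ h h' := Fin.castPred_le_castPred_iff.2 (T.row_weak _ _ h h')
  col_strict _ _ h h' := Fin.castPred_lt_castPred_iff.2 (T.col_strict _ _ h h')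

theorem SkewTableau.extend_restrict (T : SkewTableau lam mu (Fin (k + 1))) :
    T.restrict.extend T.hStrip_innerShape = T := by
  apply SkewTableau.entry_injective
  funext ⟨c, hc⟩
  simp only [SkewTableau.extend]
  by_cases h : c ∈ T.innerShape.cells \ mu.cells
  · rw [extendEntry_of_mem _ h]
    simp [SkewTableau.restrict]
  · rw [extendEntry_of_notMem _ h]
    simp only [Finset.mem_sdiff, YoungDiagram.mem_cells, mem_innerShape, not_and, not_not] at h hc
    by_contra hne
    exact hc.2 (h ⟨hc.1, fun _ => Ne.symm hne⟩)

theorem SkewTableau.weight_extend {M : Type*} [CommMonoid M] (hs : HStrip nu lam) (hmn : mu ≤ nu)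
    (x : Fin (k + 1) → M) (T : SkewTableau nu mu (Fin k)) :
    (T.extend hs).weight x =
      T.weight (fun i => x i.castSucc) * x (Fin.last k) ^ (lam.card - nu.card) := by
  have hd : lam.cells \ mu.cells = (nu.cells \ mu.cells) ∪ (lam.cells \ nu.cells) := by
    have h1 := YoungDiagram.cells_subset_iff.2 hs.1
    have h2 := YoungDiagram.cells_subset_iff.2 hmn
    ext c
    have h1' := @h1 c
    have h2' := @h2 c
    simp only [Finset.mem_sdiff, Finset.mem_union]
    tauto
  have hdisj : Disjoint (nu.cells \ mu.cells) (lam.cells \ nu.cells) :=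
    Finset.disjoint_left.2 fun c h h' => (Finset.mem_sdiff.1 h').2 (Finset.mem_sdiff.1 h).1
  calc (T.extend hs).weight x = ∏ c ∈ lam.cells \ mu.cells, x (T.extendEntry c) :=
        Finset.prod_coe_sort (lam.cells \ mu.cells) fun c => x (T.extendEntry c)
    _ = (∏ c ∈ nu.cells \ mu.cells, x (T.extendEntry c)) *
        ∏ c ∈ lam.cells \ nu.cells, x (T.extendEntry c) := by
        rw [hd, Finset.prod_union hdisj]
    _ = _ := by
        congr 1
        · rw [← Finset.prod_coe_sort]
          refine Finset.prod_congr rfl fun c _ => ?_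
          rw [T.extendEntry_of_mem c.2]
        · rw [Finset.prod_congr rfl (g := fun _ => x (Fin.last k)), Finset.prod_const,
            Finset.card_sdiff_of_subset (YoungDiagram.cells_subset_iff.2 hs.1)]
          intro c hc
          rw [T.extendEntry_of_notMem]
          simp only [Finset.mem_sdiff] at hc ⊢
          tauto

open Classical in
/-- Sorting the tableaux of a shape by the position of the largest letter. -/
theorem sum_skewTableau_succ {B : Type*} [AddCommMonoid B] (hmu : mu ≤ lam)
    (F : SkewTableau lam mu (Fin (k + 1)) → B) (G : ∀ nu, SkewTableau nu mu (Fin k) → B)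
    (hFG : ∀ nu (hs : HStrip nu lam), mu ≤ nu → ∀ T, F (T.extend hs) = G nu T) :
    ∑ T, F T =
      ∑ nu ∈ (subdiagrams lam).filter fun nu => mu ≤ nu ∧ HStrip nu lam, ∑ T, G nu T := by
  rw [← Finset.sum_fiberwise_of_maps_to (g := fun T => T.innerShape)
    (t := (subdiagrams lam).filter fun nu => mu ≤ nu ∧ HStrip nu lam)]
  · refine Finset.sum_congr rfl fun nu hnu => ?_
    simp only [Finset.mem_filter, mem_subdiagrams] at hnu
    obtain ⟨-, hmn, hs⟩ := hnu
    symm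
    refine Finset.sum_bij (fun T _ => T.extend hs) ?_ ?_ ?_ ?_
    · intro T _
      simp [T.innerShape_extend hs hmn]
    · intro T _ T' _ h
      exact SkewTableau.extend_injective hs h
    · intro T hT
      simp only [Finset.mem_filter, Finset.mem_univ, true_and] at hT
      subst hT
      exact ⟨T.restrict, Finset.mem_univ _, T.extend_restrict⟩
    · intro T _
      exact (hFG nu hs hmn T).symm
  · intro T _
    simp only [Finset.mem_filter, mem_subdiagrams]
    exact ⟨T.innerShape_le, T.le_innerShape hmu, T.hStrip_innerShape⟩

/-- The skew Schur polynomial of `lam/mu` evaluated at finitely many elements of a ring. -/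
def skewEval {A : Type*} [CommRing A] {k : ℕ} (x : Fin k → A) (lam mu : YoungDiagram) : A :=
  ∑ T : SkewTableau lam mu (Fin k), T.weight x

-- The branching rule: the largest letter occupies a horizontal strip, and each of its cells
-- contributes the last variable.
open Classical in
theorem skewEval_succ {A : Type*} [CommRing A] (x : Fin (k + 1) → A) (hmu : mu ≤ lam) :
    skewEval x lam mu = ∑ nu ∈ (subdiagrams lam).filter fun nu => mu ≤ nu ∧ HStrip nu lam,
      skewEval (fun i => x i.castSucc) nu mu * x (Fin.last k) ^ (lam.card - nu.card) := by
  simp only [skewEval, Finset.sum_mul]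
  exact sum_skewTableau_succ hmu _ _ fun nu hs hmn T => T.weight_extend hs hmn x

theorem skewEval_zero {A : Type*} [CommRing A] (x : Fin 0 → A) (hmu : mu ≤ lam)
    [Decidable (mu = lam)] :
    skewEval x lam mu = if mu = lam then 1 else 0 := by
  split_ifs with h
  · subst h
    have : IsEmpty {c : ℕ × ℕ // c ∈ mu.cells \ mu.cells} := ⟨fun c => by simpa using c.2⟩
    have : Unique (SkewTableau mu mu (Fin 0)) :=
      { default := ⟨fun c => isEmptyElim c, fun c => isEmptyElim c, fun c => isEmptyElim c⟩
        uniq := fun T => SkewTableau.entry_injective (Subsingleton.elim _ _) }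
    simp [skewEval, SkewTableau.weight]
  · have : IsEmpty (SkewTableau lam mu (Fin 0)) := by
      refine ⟨fun T => h (le_antisymm hmu fun c hc => ?_)⟩
      by_contra hn
      exact (T.entry ⟨c, by simpa [hc] using hn⟩).elim0
    simp [skewEval]

end Tableaux

/-! ### Diagrams and the vectors of their row lengths -/

section Rows

variable {lam mu nu : YoungDiagram}

theorem rowLen_eq_zero_of_colLen_le {i : ℕ} (h : lam.colLen 0 ≤ i) : lam.rowLen i = 0 := by
  by_contra hne
  have : (i, 0) ∈ lam := YoungDiagram.mem_iff_lt_rowLen.2 (Nat.pos_of_ne_zero hne)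
  exact absurd (YoungDiagram.mem_iff_lt_colLen.1 this) (not_lt.2 h)

theorem colLen_le_iff {N : ℕ} : lam.colLen 0 ≤ N ↔ lam.rowLen N = 0 := by
  refine ⟨rowLen_eq_zero_of_colLen_le, fun h => ?_⟩
  by_contra hlt
  have := YoungDiagram.mem_iff_lt_rowLen.1 (YoungDiagram.mem_iff_lt_colLen.2 (not_le.1 hlt))
  omega

theorem rowLen_pos_iff {i : ℕ} : 0 < lam.rowLen i ↔ i < lam.colLen 0 := by
  rw [← YoungDiagram.mem_iff_lt_rowLen, YoungDiagram.mem_iff_lt_colLen]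

theorem le_iff_rowLen : mu ≤ lam ↔ ∀ i, mu.rowLen i ≤ lam.rowLen i := by
  constructor
  · intro h i
    by_contra hlt
    have := h (YoungDiagram.mem_iff_lt_rowLen.2 (not_le.1 hlt))
    exact absurd (YoungDiagram.mem_iff_lt_rowLen.1 this) (lt_irrefl _)
  · rintro h ⟨i, j⟩ hc
    exact YoungDiagram.mem_iff_lt_rowLen.2 ((YoungDiagram.mem_iff_lt_rowLen.1 hc).trans_le (h i))

theorem ext_rowLen (h : ∀ i, mu.rowLen i = lam.rowLen i) : mu = lam :=
  le_antisymm (le_iff_rowLen.2 fun i => (h i).le) (le_iff_rowLen.2 fun i => (h i).ge)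

theorem hStrip_iff_rowLen : HStrip nu lam ↔
    (∀ i, nu.rowLen i ≤ lam.rowLen i) ∧ ∀ i, lam.rowLen (i + 1) ≤ nu.rowLen i := by
  rw [HStrip, le_iff_rowLen]
  refine and_congr_right fun _ => forall_congr' fun i => ⟨fun h => ?_, fun h j hj => ?_⟩
  · by_contra hlt
    have := h _ (YoungDiagram.mem_iff_lt_rowLen.2 (not_le.1 hlt))
    exact absurd (YoungDiagram.mem_iff_lt_rowLen.1 this) (lt_irrefl _)
  · exact YoungDiagram.mem_iff_lt_rowLen.2 ((YoungDiagram.mem_iff_lt_rowLen.1 hj).trans_le h)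

/-- Transposed horizontal strips are vertical strips. -/
theorem hStrip_transpose_iff_rowLen : HStrip nu.transpose lam.transpose ↔
    ∀ i, nu.rowLen i ≤ lam.rowLen i ∧ lam.rowLen i ≤ nu.rowLen i + 1 := by
  rw [HStrip, YoungDiagram.transpose_le_iff, le_iff_rowLen, forall_and]
  refine and_congr_right fun _ => ?_
  have e : (∀ i j, (i + 1, j) ∈ lam.transpose → (i, j) ∈ nu.transpose) ↔
      ∀ i j, i + 1 < lam.rowLen j → i < nu.rowLen j := by
    simp only [YoungDiagram.mem_transpose, Prod.swap_prod_mk]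
    simp only [YoungDiagram.mem_iff_lt_rowLen]
  rw [e]
  constructor
  · intro h i
    by_contra hlt
    exact absurd (h (nu.rowLen i) i (not_le.1 hlt)) (lt_irrefl _)
  · intro h i j hj
    have := h j
    omega

/-- The first `N` row lengths. -/
def rowVec (N : ℕ) (lam : YoungDiagram) : Fin N → ℕ := fun i => lam.rowLen i

theorem card_eq_sum_rowLen {N : ℕ} (h : lam.colLen 0 ≤ N) :
    lam.card = ∑ i : Fin N, lam.rowLen i := by
  rw [Fin.sum_univ_eq_sum_range (fun i => lam.rowLen i), YoungDiagram.card,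
    Finset.card_eq_sum_card_fiberwise (f := Prod.fst) (t := Finset.range N)]
  · refine Finset.sum_congr rfl fun i _ => ?_
    rw [YoungDiagram.rowLen_eq_card]
    rfl
  · rintro ⟨i, j⟩ hc
    simp only [Finset.coe_range, Set.mem_Iio]
    have h1 : (i, 0) ∈ lam :=
      lam.up_left_mem le_rfl (Nat.zero_le j) ((YoungDiagram.mem_cells _).1 hc)
    exact (YoungDiagram.mem_iff_lt_colLen.1 h1).trans_le h

theorem rowVec_injOn {N : ℕ} (hmu : mu.colLen 0 ≤ N) (hlam : lam.colLen 0 ≤ N)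
    (h : rowVec N mu = rowVec N lam) : mu = lam := by
  refine ext_rowLen fun i => ?_
  by_cases hi : i < N
  · exact congrFun h ⟨i, hi⟩
  · rw [rowLen_eq_zero_of_colLen_le (hmu.trans (not_lt.1 hi)),
      rowLen_eq_zero_of_colLen_le (hlam.trans (not_lt.1 hi))]

theorem exists_rowVec_eq {N : ℕ} {p : Fin N → ℕ} (hp : Antitone p) :
    ∃ lam : YoungDiagram, lam.colLen 0 ≤ N ∧ rowVec N lam = p := by
  have hs : (List.ofFn p).SortedGE := List.sortedGE_ofFn_iff.2 hp
  refine ⟨YoungDiagram.ofRowLens _ hs, ?_, ?_⟩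
  · by_contra hlt
    have := YoungDiagram.mem_iff_lt_colLen.2 (not_le.1 hlt)
    rw [YoungDiagram.mem_ofRowLens] at this
    obtain ⟨h, -⟩ := this
    simp at h
  · funext i
    have := YoungDiagram.rowLen_ofRowLens (hw := hs) ⟨i, by simp⟩
    simpa [rowVec] using this

/-- Rewriting a sum over integer vectors, in which only partitions contribute, as a sum over
Young diagrams. -/
theorem sum_rowVec {B : Type*} [AddCommMonoid B] {N : ℕ} (s : Finset YoungDiagram)
    (P : Finset (Fin N → ℕ)) (f : (Fin N → ℕ) → B)
    (hs : ∀ nu ∈ s, nu.colLen 0 ≤ N ∧ rowVec N nu ∈ P)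
    (hP : ∀ p ∈ P, (∃ nu ∈ s, rowVec N nu = p) ∨ f p = 0) :
    ∑ p ∈ P, f p = ∑ nu ∈ s, f (rowVec N nu) := by
  classical
  rw [← Finset.sum_image (f := f) (g := rowVec N) (s := s)]
  · symm
    refine Finset.sum_subset (fun p hp => ?_) fun p hp hp' => ?_
    · obtain ⟨nu, hnu, rfl⟩ := Finset.mem_image.1 hp
      exact (hs nu hnu).2
    · refine (hP p hp).resolve_left fun h => hp' ?_
      obtain ⟨nu, hnu, rfl⟩ := h
      exact Finset.mem_image_of_mem _ hnu
  · intro a ha b hb h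
    exact rowVec_injOn (hs a ha).1 (hs b hb).1 h

end Rows

/-! ### Determinants -/

section Det

open Matrix

variable {A : Type*} [CommRing A]

/-- Reversing rows and columns exchanges the roles of next and preceding row. The row added is one
of `M` itself, so all the operations can be specified at once. -/
theorem det_eq_of_forall_row_eq_smul_add_succ {n : ℕ} {M M' : Matrix (Fin (n + 1)) (Fin (n + 1)) A}
    (c : Fin n → A) (h_last : ∀ j, M (Fin.last n) j = M' (Fin.last n) j)
    (h : ∀ (i : Fin n) j, M i.castSucc j = M' i.castSucc j + c i * M i.succ j) :
    M.det = M'.det := by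
  rw [← det_submatrix_equiv_self Fin.revPerm M, ← det_submatrix_equiv_self Fin.revPerm M']
  refine det_eq_of_forall_row_eq_smul_add_pred (fun i => c i.rev) (fun j => ?_) fun i j => ?_
  · simp [h_last]
  · simp only [submatrix_apply, Fin.revPerm_apply, Fin.rev_succ, Fin.rev_castSucc]
    exact h _ _

theorem det_eq_of_forall_col_eq_smul_add_succ {n : ℕ} {M M' : Matrix (Fin (n + 1)) (Fin (n + 1)) A}
    (c : Fin n → A) (h_last : ∀ i, M i (Fin.last n) = M' i (Fin.last n))
    (h : ∀ i (j : Fin n), M i j.castSucc = M' i j.castSucc + c j * M i j.succ) :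
    M.det = M'.det := by
  rw [← det_transpose M, ← det_transpose M']
  exact det_eq_of_forall_row_eq_smul_add_succ c h_last fun i j => h j i

/-- Expanding a determinant whose rows are sums. -/
theorem det_sum_rows {N : ℕ} {κ : Type*} [DecidableEq κ] (S : Fin N → Finset κ)
    (c : Fin N → κ → A) (r : Fin N → κ → Fin N → A) :
    det (of fun i j => ∑ q ∈ S i, c i q * r i q j) =
      ∑ p ∈ Fintype.piFinset S, (∏ i, c i (p i)) * det (of fun i j => r i (p i) j) := by
  have h : (of fun i j => ∑ q ∈ S i, c i q * r i q j : Matrix (Fin N) (Fin N) A) =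
      fun i => ∑ q ∈ S i, fun j => c i q * r i q j := by
    ext i j
    simp
  have h2 := (detRowAlternating (n := Fin N) (R := A)).toMultilinearMap.map_sum_finset
    (fun i q j => c i q * r i q j) S
  rw [h]
  refine h2.trans (Finset.sum_congr rfl fun p _ => ?_)
  exact det_mul_column (fun i => c i (p i)) (of fun i j => r i (p i) j)

end Det

/-! ### Jacobi–Trudi determinants -/

section JacobiTrudi

open Matrix PowerSeries

variable {A : Type*} [CommRing A]

/-- The coefficients of a power series, extended by zero to negative degrees. -/
def zcoeff (f : A⟦X⟧) (n : ℤ) : A := if n < 0 then 0 else coeff n.toNat f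

theorem zcoeff_of_neg (f : A⟦X⟧) {n : ℤ} (h : n < 0) : zcoeff f n = 0 := if_pos h

@[simp] theorem zcoeff_natCast (f : A⟦X⟧) (n : ℕ) : zcoeff f n = coeff n f := by
  simp [zcoeff]

theorem zcoeff_zero (f : A⟦X⟧) : zcoeff f 0 = constantCoeff f := by
  simp [zcoeff]

theorem zcoeff_mul_one_add (f : A⟦X⟧) (y : A) (n : ℤ) :
    zcoeff (f * (1 + C y * X)) n = zcoeff f n + y * zcoeff f (n - 1) := by
  rcases lt_or_ge n 0 with h | h
  · simp [zcoeff_of_neg _ h, zcoeff_of_neg f (show n - 1 < 0 by omega)]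
  · lift n to ℕ using h
    have e : f * (1 + C y * X) = f + C y * (f * X) := by ring
    rw [zcoeff_natCast, e]
    cases n with
    | zero => simp [zcoeff]
    | succ n =>
      rw [show ((n + 1 : ℕ) : ℤ) - 1 = (n : ℕ) by push_cast; ring, zcoeff_natCast, zcoeff_natCast]
      simp [coeff_succ_mul_X]

/-- The determinant of the `h_{p_i - i + j}`, for the coefficients `h_n` of a power series. -/
def jtVec (f : A⟦X⟧) {N : ℕ} (p : Fin N → ℕ) : A :=
  det (of fun i j : Fin N => zcoeff f ((p i : ℤ) - (i : ℤ) + (j : ℤ)))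

/-- The Jacobi–Trudi determinant of a partition. -/
def jacobiTrudi (f : A⟦X⟧) (lam : YoungDiagram) : A := jtVec f (rowVec (lam.colLen 0) lam)

/-- A zero part adds a last row `(0, …, 0, 1)`, since the degrees left of the diagonal are negative.
Padding by zeros is thus harmless, which allows diagrams of different heights in determinants of one
size. -/
theorem jtVec_rowVec_succ {f : A⟦X⟧} (hf : constantCoeff f = 1) {N : ℕ} {lam : YoungDiagram}
    (h : lam.colLen 0 ≤ N) : jtVec f (rowVec (N + 1) lam) = jtVec f (rowVec N lam) := by
  rw [jtVec, det_succ_row _ (Fin.last N), Finset.sum_eq_single (Fin.last N)]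
  · have h0 : rowVec (N + 1) lam (Fin.last N) = 0 := rowLen_eq_zero_of_colLen_le h
    simp only [of_apply, h0, Fin.val_last]
    rw [show ((0 : ℕ) : ℤ) - N + N = 0 by simp, zcoeff_zero, hf, Even.neg_one_pow ⟨N, rfl⟩]
    simp only [one_mul, jtVec, Fin.succAbove_last]
    rfl
  · intro j _ hj
    have h0 : rowVec (N + 1) lam (Fin.last N) = 0 := rowLen_eq_zero_of_colLen_le h
    have hj' : (j : ℕ) < N := Fin.val_lt_last hj
    simp only [of_apply, h0, Fin.val_last]
    rw [zcoeff_of_neg _ (by push_cast; omega)]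
    simp
  · simp

theorem jtVec_rowVec {f : A⟦X⟧} (hf : constantCoeff f = 1) {N : ℕ} {lam : YoungDiagram}
    (h : lam.colLen 0 ≤ N) : jtVec f (rowVec N lam) = jacobiTrudi f lam := by
  induction N, h using Nat.le_induction with
  | base => rfl
  | succ N h ih => rw [jtVec_rowVec_succ hf h, ih]

theorem jacobiTrudi_bot {f : A⟦X⟧} (hf : constantCoeff f = 1) : jacobiTrudi f ⊥ = 1 := by
  have h0 : (⊥ : YoungDiagram).colLen 0 ≤ 0 := by
    by_contra h
    exact YoungDiagram.notMem_bot _ (YoungDiagram.mem_iff_lt_colLen.2 (not_le.1 h))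
  rw [← jtVec_rowVec hf h0]
  simp [jtVec]

/-- The first row of a nonempty partition involves only positive degrees, where the series `1`
vanishes. This isolates the term `mu = ⊥` when the expansions below start from the trivial series.
-/
theorem jacobiTrudi_one [DecidableEq YoungDiagram] (lam : YoungDiagram) :
    jacobiTrudi (1 : A⟦X⟧) lam = if lam = ⊥ then 1 else 0 := by
  split_ifs with h
  · subst h
    exact jacobiTrudi_bot (by simp)
  · have hpos : 0 < lam.colLen 0 := by
      by_contra h0
      refine h (le_antisymm ?_ bot_le)
      rintro ⟨i, j⟩ hc
      have h1 : (0, 0) ∈ lam := lam.up_left_mem (Nat.zero_le i) (Nat.zero_le j) hc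
      exact absurd (YoungDiagram.mem_iff_lt_colLen.1 h1) h0
    refine det_eq_zero_of_row_eq_zero ⟨0, hpos⟩ fun j => ?_
    have h1 : 0 < lam.rowLen 0 := rowLen_pos_iff.2 hpos
    simp only [of_apply, rowVec]
    rw [show (lam.rowLen 0 : ℤ) - (0 : ℕ) + (j : ℕ) = (lam.rowLen 0 + j : ℕ) by push_cast; ring,
      zcoeff_natCast, coeff_one, if_neg (by omega)]

/-- A telescoped form of the recursion `h'_n - y h'_{n-1} = h_n`. -/
theorem zcoeff_eq_sum_Icc_add {f f' : A⟦X⟧} {y : A} (hff : f' * (1 - C y * X) = f) {a b : ℕ}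
    (hab : a ≤ b) (m : ℤ) :
    zcoeff f' (b + m) = ∑ q ∈ Finset.Icc a b, y ^ (b - q) * zcoeff f (q + m) +
      y ^ (b + 1 - a) * zcoeff f' (a - 1 + m) := by
  have h (m : ℤ) : zcoeff f' m = zcoeff f m + y * zcoeff f' (m - 1) := by
    have h1 : f = f' * (1 + C (-y) * X) := by rw [← hff, map_neg]; ring
    rw [h1, zcoeff_mul_one_add]
    ring
  induction b, hab using Nat.le_induction with
  | base =>
    rw [h, Finset.Icc_self, Finset.sum_singleton, Nat.sub_self, Nat.add_sub_cancel_left,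
      show (a : ℤ) + m - 1 = a - 1 + m by ring]
    simp
  | succ b hab ih =>
    rw [h, show ((b + 1 : ℕ) : ℤ) + m - 1 = b + m by push_cast; ring, ih,
      Finset.sum_Icc_succ_top (by omega), mul_add, Finset.mul_sum, Nat.sub_self,
      show b + 1 + 1 - a = b + 1 - a + 1 by omega]
    rw [Finset.sum_congr rfl (g := fun q => y ^ (b + 1 - q) * zcoeff f (q + m))]
    · ring
    · intro q hq
      rw [← mul_assoc, ← pow_succ', Nat.succ_sub (Finset.mem_Icc.1 hq).2]

end JacobiTrudi

/-! ### Branching rules for Jacobi–Trudi determinants -/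

section Branching

open Matrix PowerSeries

variable {A : Type*} [CommRing A]

open Classical in
/-- Jacobi–Trudi determinants under the adjunction of a variable `y`, when the generating series
is multiplied by `1 / (1 - y t)`. -/
theorem jacobiTrudi_hStrip {f f' : A⟦X⟧} {y : A} (hf : constantCoeff f = 1)
    (hff : f' * (1 - C y * X) = f) (lam : YoungDiagram) :
    jacobiTrudi f' lam = ∑ nu ∈ (subdiagrams lam).filter fun nu => HStrip nu lam,
      y ^ (lam.card - nu.card) * jacobiTrudi f nu := by
  have hf' : constantCoeff f' = 1 := by
    rw [← hf, ← hff]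
    simp
  set n := lam.colLen 0 with hn
  have hlast : lam.rowLen n = 0 := rowLen_eq_zero_of_colLen_le le_rfl
  have hlast' : lam.rowLen (n + 1) = 0 := rowLen_eq_zero_of_colLen_le (Nat.le_succ n)
  have hdet : jacobiTrudi f' lam = det (of fun i j : Fin (n + 1) =>
      ∑ q ∈ Finset.Icc (lam.rowLen (i + 1)) (lam.rowLen i),
        y ^ (lam.rowLen i - q) * zcoeff f ((q : ℤ) - (i : ℤ) + (j : ℤ))) := by
    rw [← jtVec_rowVec hf' (Nat.le_succ n)]
    -- Telescoping row `i` down to degree `lam.rowLen (i + 1)` leaves a multiple of row `i + 1`,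
    -- because the shift `lam.rowLen (i + 1) - 1 - i` is that of row `i + 1`. In the last row the
    -- remainder has negative degree. The extra zero row makes the size a successor even for the
    -- empty diagram.
    have key (i j : ℕ) := zcoeff_eq_sum_Icc_add hff
      (lam.rowLen_anti i (i + 1) (Nat.le_succ i)) (-(i : ℤ) + (j : ℤ))
    refine det_eq_of_forall_row_eq_smul_add_succ
      (fun i => y ^ (lam.rowLen i + 1 - lam.rowLen (i + 1))) (fun j => ?_) fun i j => ?_
    · simp only [of_apply, rowVec, Fin.val_last, sub_add]
      have := key n j
      rw [zcoeff_of_neg f' (n := _ - 1 + _) (by rw [hlast']; push_cast; omega), mul_zero,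
        add_zero] at this
      simpa only [neg_add_eq_sub, ← sub_add, ← add_sub_assoc, add_sub_right_comm] using this
    · simp only [of_apply, rowVec, Fin.val_castSucc, Fin.val_succ]
      have := key i j
      rw [show ((lam.rowLen i : ℕ) : ℤ) - (i : ℕ) + (j : ℕ) = lam.rowLen i + (-(i : ℤ) + j) by ring,
        this]
      congr 1
      · refine Finset.sum_congr rfl fun q _ => ?_
        congr 2
        ring
      · congr 2
        push_cast
        ring
  rw [hdet, det_sum_rows (fun i : Fin (n + 1) => Finset.Icc (lam.rowLen (i + 1)) (lam.rowLen i))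
    (fun i q => y ^ (lam.rowLen i - q)) (fun i q j => zcoeff f ((q : ℤ) - (i : ℤ) + (j : ℤ))),
    sum_rowVec ((subdiagrams lam).filter fun nu => HStrip nu lam)]
  · refine Finset.sum_congr rfl fun nu hnu => ?_
    simp only [Finset.mem_filter, mem_subdiagrams] at hnu
    have hnu' : nu.colLen 0 ≤ n + 1 := by
      rw [colLen_le_iff]
      have := le_iff_rowLen.1 hnu.1 (n + 1)
      omega
    congr 1
    · rw [Finset.prod_pow_eq_pow_sum, card_eq_sum_rowLen hnu',
        card_eq_sum_rowLen (hn.ge.trans (Nat.le_succ n)), ← Finset.sum_tsub_distrib]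
      · rfl
      · exact fun i _ => le_iff_rowLen.1 hnu.1 i
    · exact jtVec_rowVec hf hnu'
  · intro nu hnu
    simp only [Finset.mem_filter, mem_subdiagrams] at hnu
    have hr := hStrip_iff_rowLen.1 hnu.2
    refine ⟨?_, ?_⟩
    · rw [colLen_le_iff]
      have := hr.1 (n + 1)
      omega
    · exact Fintype.mem_piFinset.2 fun i => Finset.mem_Icc.2 ⟨hr.2 i, hr.1 i⟩
  · intro p hp
    left
    have hp' (i : Fin (n + 1)) := Finset.mem_Icc.1 (Fintype.mem_piFinset.1 hp i)
    -- The intervals from `lam.rowLen (i + 1)` to `lam.rowLen i` interlace, so every choice `p` is a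
    -- partition, and interlacing with `lam` is the horizontal strip condition.
    have hanti : Antitone p := by
      refine Fin.antitone_iff_succ_le.2 fun i => ?_
      exact (hp' i.succ).2.trans (hp' i.castSucc).1
    obtain ⟨nu, hnu, rfl⟩ := exists_rowVec_eq hanti
    have hs : HStrip nu lam := by
      rw [hStrip_iff_rowLen]
      refine ⟨fun i => ?_, fun i => ?_⟩ <;> by_cases hi : i < n + 1
      · exact (hp' ⟨i, hi⟩).2
      · rw [rowLen_eq_zero_of_colLen_le (hnu.trans (not_lt.1 hi))]
        exact Nat.zero_le _
      · exact (hp' ⟨i, hi⟩).1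
      · rw [rowLen_eq_zero_of_colLen_le (lam := lam) (by omega)]
        exact Nat.zero_le _
    exact ⟨nu, Finset.mem_filter.2 ⟨mem_subdiagrams.2 hs.1, hs⟩, rfl⟩

open Classical in
/-- Jacobi–Trudi determinants under the adjunction of a variable `y`, when the generating series
is multiplied by `1 + y t`. -/
theorem jacobiTrudi_vStrip {f : A⟦X⟧} (y : A) (hf : constantCoeff f = 1) (lam : YoungDiagram) :
    jacobiTrudi (f * (1 + C y * X)) lam =
      ∑ nu ∈ (subdiagrams lam).filter fun nu => HStrip nu.transpose lam.transpose,
        y ^ (lam.card - nu.card) * jacobiTrudi f nu := by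
  set n := lam.colLen 0 with hn
  have hpos (i : Fin n) : 0 < lam.rowLen i := rowLen_pos_iff.2 i.2
  have hdet : jacobiTrudi (f * (1 + C y * X)) lam = det (of fun i j : Fin n =>
      ∑ q ∈ Finset.Icc (lam.rowLen i - 1) (lam.rowLen i),
        y ^ (lam.rowLen i - q) * zcoeff f ((q : ℤ) - (i : ℤ) + (j : ℤ))) := by
    rw [jacobiTrudi, jtVec]
    congr 1
    ext i j
    simp only [of_apply, rowVec]
    -- All rows are nonempty here, so `lam.rowLen i - 1` is not truncated and the interval has
    -- exactly two elements.
    obtain ⟨m, hm⟩ := Nat.exists_eq_succ_of_ne_zero (hpos i).ne'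
    rw [hm, zcoeff_mul_one_add, Nat.succ_sub_one, Finset.sum_Icc_succ_top (Nat.le_succ m),
      Finset.Icc_self, Finset.sum_singleton]
    simp only [Nat.succ_eq_add_one, Nat.add_sub_cancel_left, Nat.sub_self, pow_one, pow_zero,
      one_mul]
    rw [add_comm]
    congr 3
    push_cast
    ring
  rw [hdet, det_sum_rows (fun i : Fin n => Finset.Icc (lam.rowLen i - 1) (lam.rowLen i))
    (fun i q => y ^ (lam.rowLen i - q)) (fun i q j => zcoeff f ((q : ℤ) - (i : ℤ) + (j : ℤ))),
    sum_rowVec ((subdiagrams lam).filter fun nu => HStrip nu.transpose lam.transpose)]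
  · refine Finset.sum_congr rfl fun nu hnu => ?_
    simp only [Finset.mem_filter, mem_subdiagrams] at hnu
    have hnu' : nu.colLen 0 ≤ n := by
      rw [colLen_le_iff]
      have := le_iff_rowLen.1 hnu.1 n
      rw [rowLen_eq_zero_of_colLen_le (lam := lam) le_rfl] at this
      omega
    congr 1
    · rw [Finset.prod_pow_eq_pow_sum, card_eq_sum_rowLen hnu',
        card_eq_sum_rowLen hn.ge, ← Finset.sum_tsub_distrib]
      · rfl
      · exact fun i _ => le_iff_rowLen.1 hnu.1 i
    · exact jtVec_rowVec hf hnu'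
  · intro nu hnu
    simp only [Finset.mem_filter, mem_subdiagrams] at hnu
    have hr := hStrip_transpose_iff_rowLen.1 hnu.2
    refine ⟨?_, ?_⟩
    · rw [colLen_le_iff]
      have := (hr n).1
      rw [rowLen_eq_zero_of_colLen_le (lam := lam) le_rfl] at this
      omega
    · refine Fintype.mem_piFinset.2 fun i => Finset.mem_Icc.2 ?_
      have := hr i
      simp only [rowVec]
      omega
  · intro p hp
    have hp' (i : Fin n) := Finset.mem_Icc.1 (Fintype.mem_piFinset.1 hp i)
    by_cases hanti : Antitone p
    · left
      obtain ⟨nu, hnu, rfl⟩ := exists_rowVec_eq hanti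
      have hs : HStrip nu.transpose lam.transpose := by
        rw [hStrip_transpose_iff_rowLen]
        intro i
        by_cases hi : i < n
        · have := hp' ⟨i, hi⟩
          simp only [rowVec] at this
          omega
        · rw [rowLen_eq_zero_of_colLen_le (hnu.trans (not_lt.1 hi)),
            rowLen_eq_zero_of_colLen_le (lam := lam) (not_lt.1 hi)]
          omega
      exact ⟨nu, Finset.mem_filter.2 ⟨mem_subdiagrams.2 (YoungDiagram.transpose_le_iff.1 hs.1),
        hs⟩, rfl⟩
    · right
      -- An ascent of `p` forces `p (i + 1) = p i + 1`: row `i` was lowered by one and row `i + 1`,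
      -- of the same length in `lam`, was not. Then `p i - i` takes the same value for both rows,
      -- and the determinant has two equal rows.
      have : ∃ i : ℕ, ∃ h : i + 1 < n, p ⟨i, by omega⟩ < p ⟨i + 1, h⟩ := by
        by_contra! hcon
        apply hanti
        intro a b hab
        obtain ⟨a, ha⟩ := a
        obtain ⟨b, hb⟩ := b
        replace hab : a ≤ b := hab
        induction b, hab using Nat.le_induction with
        | base => exact le_rfl
        | succ b hab ih => exact (hcon b hb).trans (ih (by omega))
      obtain ⟨i, h, hlt⟩ := this
      have h1 := hp' ⟨i, by omega⟩
      have h2 := hp' ⟨i + 1, h⟩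
      have h3 := lam.rowLen_anti i (i + 1) (Nat.le_succ i)
      simp only at h1 h2
      have h4 : p ⟨i + 1, h⟩ = p ⟨i, by omega⟩ + 1 := by omega
      rw [det_zero_of_row_eq (i := ⟨i, Nat.lt_of_succ_lt h⟩) (j := ⟨i + 1, h⟩) (by simp), mul_zero]
      funext j
      simp only [of_apply, h4]
      congr 1
      push_cast
      ring

end Branching

/-! ### Pieri's rule for Jacobi–Trudi determinants -/

section Pieri

open Matrix PowerSeries

variable {A : Type*} [CommRing A]

/-- The coefficients of `f` from the degree `n` on, as a power series. -/
def zshift (f : A⟦X⟧) (n : ℤ) : A⟦X⟧ := mk fun s => zcoeff f (n + s)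

theorem zshift_eq (f : A⟦X⟧) (n : ℤ) : zshift f n = C (zcoeff f n) + X * zshift f (n + 1) := by
  ext s
  cases s with
  | zero => simp [zshift]
  | succ s =>
    rw [map_add, coeff_succ_X_mul]
    simp only [zshift, coeff_mk, coeff_C, Nat.succ_ne_zero, if_false, zero_add]
    congr 1
    push_cast
    ring

theorem zshift_zero (f : A⟦X⟧) : zshift f 0 = f := by
  ext s
  simp [zshift]

theorem zshift_eq_sum_Icc_add (f : A⟦X⟧) {a b : ℕ} (hab : a ≤ b) (m : ℤ) :
    zshift f (a + m) = ∑ q ∈ Finset.Icc a b, X ^ (q - a) * C (zcoeff f (q + m)) +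
      X ^ (b + 1 - a) * zshift f (b + 1 + m) := by
  induction b, hab using Nat.le_induction with
  | base =>
    rw [zshift_eq, Finset.Icc_self, Finset.sum_singleton, Nat.sub_self, Nat.add_sub_cancel_left,
      show (a : ℤ) + m + 1 = a + 1 + m by ring]
    simp
  | succ b hab ih =>
    rw [ih, zshift_eq f (b + 1 + m), Finset.sum_Icc_succ_top (by omega),
      show b + 1 + 1 - a = b + 1 - a + 1 by omega]
    push_cast
    rw [show (b : ℤ) + 1 + m + 1 = b + 1 + 1 + m by ring]
    ring

open Classical in
/-- **Pieri's rule** for Jacobi–Trudi determinants. -/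
theorem sum_jacobiTrudi_hStrip {f : A⟦X⟧} (hf : constantCoeff f = 1) (nu : YoungDiagram) (m : ℕ) :
    ∑ lam ∈ (partitionsOf (nu.card + m)).filter fun lam => HStrip nu lam, jacobiTrudi f lam =
      coeff m f * jacobiTrudi f nu := by
  set n := nu.colLen 0 with hn
  have hlast : nu.rowLen n = 0 := rowLen_eq_zero_of_colLen_le le_rfl
  -- Each entry of the Jacobi–Trudi matrix, with a zero row appended, is replaced by the tail of `f`
  -- starting there. The determinant of these tails is evaluated in two ways.
  let R : Matrix (Fin (n + 1)) (Fin (n + 1)) A⟦X⟧ := of fun i j =>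
    zshift f ((nu.rowLen i : ℤ) - (i : ℤ) + (j : ℤ))
  -- Column operations.
  have hcol : R.det = f * C (jacobiTrudi f nu) := by
    have h1 : R.det = det (of fun i j : Fin (n + 1) => if (j : ℕ) = n then R i j else
        C (zcoeff f ((nu.rowLen i : ℤ) - (i : ℤ) + (j : ℤ)))) := by
      refine det_eq_of_forall_col_eq_smul_add_succ (fun _ => X) (fun i => ?_) fun i j => ?_
      · simp
      · simp only [of_apply, Fin.val_castSucc, if_neg j.2.ne, R, Fin.val_succ]
        rw [zshift_eq]
        push_cast
        congr 3
        ring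
    -- In the last row only the corner survives, and it is the whole series `f`; its minor is the
    -- Jacobi–Trudi matrix of `nu`.
    rw [h1, det_succ_row _ (Fin.last n), Finset.sum_eq_single (Fin.last n)]
    · simp only [of_apply, Fin.val_last, if_true, R, hlast]
      rw [show ((0 : ℕ) : ℤ) - n + n = 0 by simp, zshift_zero, Even.neg_one_pow ⟨n, rfl⟩, one_mul,
        jacobiTrudi, jtVec, RingHom.map_det]
      congr 2
      ext1 i j
      simp [Fin.succAbove_last, rowVec, j.2.ne]
    · intro j _ hj
      have hj' : (j : ℕ) < n := Fin.val_lt_last hj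
      simp only [of_apply, Fin.val_last, hlast]
      rw [if_neg hj'.ne, zcoeff_of_neg _ (by push_cast; omega)]
      simp
    · simp
  -- Row operations.
  let top (i : Fin (n + 1)) : ℕ := Fin.cases (nu.rowLen 0 + m) (fun i => nu.rowLen i) i
  have hsub (i : Fin (n + 1)) : nu.rowLen i ≤ top i := by
    cases i using Fin.cases with
    | zero => exact Nat.le_add_right _ _
    | succ i => exact nu.rowLen_anti _ _ (Nat.le_succ _)
  let M : Matrix (Fin (n + 1)) (Fin (n + 1)) A⟦X⟧ := of fun i j =>
    ∑ q ∈ Finset.Icc (nu.rowLen i) (top i),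
      X ^ (q - nu.rowLen i) * C (zcoeff f ((q : ℤ) - (i : ℤ) + (j : ℤ)))
  let W (j : Fin (n + 1)) : A⟦X⟧ := zshift f ((nu.rowLen 0 + m : ℕ) + 1 + (j : ℤ))
  have hR (i j : Fin (n + 1)) : R i j = M i j + X ^ (top i + 1 - nu.rowLen i) *
      zshift f (top i + 1 + (-(i : ℤ) + j)) := by
    have := zshift_eq_sum_Icc_add f (hsub i) (-(i : ℤ) + j)
    simp only [← add_assoc, ← sub_eq_add_neg] at this ⊢
    exact this
  -- The tail left in a row `i + 1` beyond degree `nu.rowLen i` is a multiple of row `i` of `R`. Row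
  -- 0 has no predecessor: it is cut at `nu.rowLen 0 + m`, with an error divisible by `X ^ (m + 1)`,
  -- invisible in the coefficient at `m`.
  have hrow : R.det = M.det + X ^ (m + 1) * (M.updateRow 0 W).det := by
    have h2 : M.det + X ^ (m + 1) * (M.updateRow 0 W).det =
        (M.updateRow 0 (M 0 + (X : A⟦X⟧) ^ (m + 1) • W)).det := by
      rw [det_updateRow_add, det_updateRow_smul, updateRow_eq_self]
    rw [h2]
    refine det_eq_of_forall_row_eq_smul_add_pred
      (fun i => X ^ (nu.rowLen i + 1 - nu.rowLen (i + 1))) (fun j => ?_) fun i j => ?_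
    · rw [hR, updateRow_self]
      simp only [Pi.add_apply, Pi.smul_apply, smul_eq_mul, top, Fin.cases_zero, W, Fin.val_zero]
      congr 3
      · omega
      · push_cast
        ring
    · rw [hR, updateRow_ne (Fin.succ_ne_zero i)]
      simp only [top, Fin.cases_succ, Fin.val_succ, R, of_apply, Fin.val_castSucc]
      congr 3
      push_cast
      ring
  have hcoeff : coeff m R.det = coeff m M.det := by
    rw [hrow, map_add, coeff_X_pow_mul', if_neg (by omega), add_zero]
  have hM : M.det = ∑ p ∈ Fintype.piFinset fun i : Fin (n + 1) => Finset.Icc (nu.rowLen i) (top i),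
      X ^ (∑ i, (p i - nu.rowLen i)) * C (jtVec f p) := by
    refine (det_sum_rows (fun i => Finset.Icc (nu.rowLen i) (top i))
      (fun i q => X ^ (q - nu.rowLen i))
      (fun i q j => C (zcoeff f ((q : ℤ) - (i : ℤ) + (j : ℤ))))).trans ?_
    refine Finset.sum_congr rfl fun p _ => ?_
    rw [Finset.prod_pow_eq_pow_sum, jtVec, RingHom.map_det]
    rfl
  have hnu : nu.colLen 0 ≤ n + 1 := hn.ge.trans (Nat.le_succ n)
  have hcolLen {lam : YoungDiagram} (hs : HStrip nu lam) : lam.colLen 0 ≤ n + 1 := by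
    rw [colLen_le_iff]
    have := (hStrip_iff_rowLen.1 hs).2 n
    omega
  have hsum {lam : YoungDiagram} (hs : HStrip nu lam) :
      ∑ i, (rowVec (n + 1) lam i - nu.rowLen i) = lam.card - nu.card := by
    rw [card_eq_sum_rowLen hnu, card_eq_sum_rowLen (hcolLen hs), ← Finset.sum_tsub_distrib]
    · rfl
    · exact fun i _ => le_iff_rowLen.1 hs.1 i
  have hcard {lam : YoungDiagram} (hs : HStrip nu lam) : nu.card ≤ lam.card :=
    Finset.card_le_card (YoungDiagram.cells_subset_iff.2 hs.1)
  have h := hcoeff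
  rw [hcol, coeff_mul_C, hM, map_sum] at h
  rw [h, sum_rowVec ((partitionsOf (nu.card + m)).filter fun lam => HStrip nu lam)]
  · refine Finset.sum_congr rfl fun lam hlam => ?_
    simp only [Finset.mem_filter, mem_partitionsOf] at hlam
    rw [hsum hlam.2, hlam.1, Nat.add_sub_cancel_left, coeff_X_pow_mul', if_pos le_rfl,
      Nat.sub_self, coeff_zero_C, jtVec_rowVec hf (hcolLen hlam.2)]
  · intro lam hlam
    simp only [Finset.mem_filter, mem_partitionsOf] at hlam
    have hr := hStrip_iff_rowLen.1 hlam.2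
    refine ⟨hcolLen hlam.2, Fintype.mem_piFinset.2 fun i => Finset.mem_Icc.2 ⟨hr.1 i, ?_⟩⟩
    cases i using Fin.cases with
    | zero =>
      simp only [rowVec, top, Fin.cases_zero, Fin.val_zero]
      have h1 := hsum hlam.2
      have h2 := Finset.single_le_sum (f := fun i => rowVec (n + 1) lam i - nu.rowLen i)
        (fun _ _ => Nat.zero_le _) (Finset.mem_univ 0)
      rw [h1, hlam.1] at h2
      simp only [rowVec, Fin.val_zero] at h2
      omega
    | succ i => exact hr.2 i
  · intro p hp
    have hp' (i : Fin (n + 1)) := Finset.mem_Icc.1 (Fintype.mem_piFinset.1 hp i)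
    have hanti : Antitone p := by
      refine Fin.antitone_iff_succ_le.2 fun i => ?_
      exact (hp' i.succ).2.trans (hp' i.castSucc).1
    obtain ⟨lam, hlam, rfl⟩ := exists_rowVec_eq hanti
    have hs : HStrip nu lam := by
      rw [hStrip_iff_rowLen]
      refine ⟨fun i => ?_, fun i => ?_⟩
      · by_cases hi : i < n + 1
        · exact (hp' ⟨i, hi⟩).1
        · rw [rowLen_eq_zero_of_colLen_le (lam := nu) (by omega)]
          exact Nat.zero_le _
      · by_cases hi : i < n
        · exact (hp' (Fin.succ ⟨i, hi⟩)).2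
        · rw [rowLen_eq_zero_of_colLen_le (hlam.trans (by omega))]
          exact Nat.zero_le _
    by_cases hm : lam.card = nu.card + m
    · exact Or.inl ⟨lam, Finset.mem_filter.2 ⟨mem_partitionsOf.2 hm, hs⟩, rfl⟩
    -- A strip with a number of cells other than `m` contributes to another power of `X`.
    · right
      have := hcard hs
      rw [hsum hs, coeff_X_pow_mul', coeff_C]
      split_ifs
      · omega
      · rfl
      · rfl

end Pieri

/-! ### Generating series, Jacobi–Trudi identities and conjugation -/

section Series

open PowerSeries

variable {A : Type*} [CommRing A]

theorem card_transpose (lam : YoungDiagram) : lam.transpose.card = lam.card :=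
  Finset.card_map _

theorem transpose_bot : (⊥ : YoungDiagram).transpose = ⊥ := by
  apply SetLike.ext
  intro c
  simp [YoungDiagram.mem_transpose]

/-- The series `1 / (1 - y t)`. -/
def geomSeries (y : A) : A⟦X⟧ := mk fun n => y ^ n

theorem geomSeries_mul (y : A) : geomSeries y * (1 - C y * X) = 1 := by
  have h : geomSeries y = rescale y (mk 1) := by
    ext n
    simp [geomSeries]
  have h1 := congrArg (rescale y) (mk_one_mul_one_sub_eq_one A)
  rw [map_mul, map_sub, map_one, rescale_X] at h1
  rw [h, h1]

@[simp] theorem constantCoeff_geomSeries (y : A) : constantCoeff (geomSeries y) = 1 := by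
  rw [← coeff_zero_eq_constantCoeff_apply]
  simp [geomSeries]

/-- The generating series of the complete homogeneous symmetric polynomials. -/
def hSeries {k : ℕ} (x : Fin k → A) : A⟦X⟧ := ∏ i, geomSeries (x i)

/-- The generating series of the elementary symmetric polynomials. -/
def eSeries {k : ℕ} (x : Fin k → A) : A⟦X⟧ := ∏ i, (1 + C (x i) * X)

@[simp] theorem constantCoeff_hSeries {k : ℕ} (x : Fin k → A) :
    constantCoeff (hSeries x) = 1 := by
  simp [hSeries, map_prod]

@[simp] theorem constantCoeff_eSeries {k : ℕ} (x : Fin k → A) :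
    constantCoeff (eSeries x) = 1 := by
  simp [eSeries, map_prod]

theorem hSeries_succ {k : ℕ} (x : Fin (k + 1) → A) :
    hSeries x = hSeries (fun i => x i.castSucc) * geomSeries (x (Fin.last k)) :=
  Fin.prod_univ_castSucc _

theorem eSeries_succ {k : ℕ} (x : Fin (k + 1) → A) :
    eSeries x = eSeries (fun i => x i.castSucc) * (1 + C (x (Fin.last k)) * X) :=
  Fin.prod_univ_castSucc _

open Classical in
theorem jacobiTrudi_mul_geomSeries {f : A⟦X⟧} (hf : constantCoeff f = 1) (y : A)
    (lam : YoungDiagram) :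
    jacobiTrudi (f * geomSeries y) lam =
      ∑ nu ∈ (subdiagrams lam).filter fun nu => HStrip nu lam,
        y ^ (lam.card - nu.card) * jacobiTrudi f nu :=
  jacobiTrudi_hStrip hf (by rw [mul_assoc, geomSeries_mul, mul_one]) lam

open Classical in
/-- Composition of branching rules. -/
theorem sum_sum_strip (P : YoungDiagram → Prop) (lam : YoungDiagram) (w G : YoungDiagram → A)
    (K : YoungDiagram → YoungDiagram → A) :
    ∑ nu ∈ (subdiagrams lam).filter P, w nu * ∑ mu ∈ subdiagrams nu, K nu mu * G mu =
      ∑ mu ∈ subdiagrams lam,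
        (∑ nu ∈ (subdiagrams lam).filter fun nu => mu ≤ nu ∧ P nu, K nu mu * w nu) * G mu := by
  simp only [Finset.mul_sum, Finset.sum_mul]
  rw [Finset.sum_comm' (t' := subdiagrams lam)
    (s' := fun mu => (subdiagrams lam).filter fun nu => mu ≤ nu ∧ P nu)]
  · refine Finset.sum_congr rfl fun _ _ => Finset.sum_congr rfl fun _ _ => ?_
    ring
  · intro nu mu
    simp only [Finset.mem_filter, mem_subdiagrams]
    constructor
    · rintro ⟨⟨h1, h2⟩, h3⟩
      exact ⟨⟨h1, h3, h2⟩, h3.trans h1⟩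
    · rintro ⟨⟨h1, h3, h2⟩, -⟩
      exact ⟨⟨h1, h2⟩, h3⟩

/-- Splitting off the last variable, both sides branch along the same horizontal strips. Keeping `f`
arbitrary makes skew shapes appear and allows a second family of factors to be multiplied in. -/
theorem jacobiTrudi_mul_hSeries {f : A⟦X⟧} (hf : constantCoeff f = 1) {k : ℕ} (x : Fin k → A)
    (lam : YoungDiagram) :
    jacobiTrudi (f * hSeries x) lam =
      ∑ mu ∈ subdiagrams lam, skewEval x lam mu * jacobiTrudi f mu := by
  classical
  induction k generalizing lam with
  | zero =>
    rw [Finset.sum_eq_single lam]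
    · simp [hSeries, skewEval_zero]
    · intro mu hmu hne
      rw [skewEval_zero x (mem_subdiagrams.1 hmu), if_neg hne, zero_mul]
    · simp [mem_subdiagrams]
  | succ k ih =>
    rw [hSeries_succ, ← mul_assoc, jacobiTrudi_mul_geomSeries (by simp [hf])]
    simp only [ih]
    rw [sum_sum_strip (fun nu => HStrip nu lam)]
    refine Finset.sum_congr rfl fun mu hmu => ?_
    rw [skewEval_succ x (mem_subdiagrams.1 hmu)]

theorem sum_subdiagrams_transpose {B : Type*} [AddCommMonoid B] (lam : YoungDiagram)
    (F : YoungDiagram → B) :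
    ∑ nu ∈ subdiagrams lam.transpose, F nu = ∑ nu ∈ subdiagrams lam, F nu.transpose := by
  refine Finset.sum_bij' (fun nu _ => nu.transpose) (fun nu _ => nu.transpose) ?_ ?_ ?_ ?_ ?_
  · intro nu hnu
    rw [mem_subdiagrams] at hnu ⊢
    rwa [← YoungDiagram.transpose_le_iff, YoungDiagram.transpose_transpose]
  · intro nu hnu
    rw [mem_subdiagrams] at hnu ⊢
    rwa [YoungDiagram.transpose_le_iff]
  all_goals simp

open Classical in
theorem skewEval_transpose_succ {k : ℕ} (x : Fin (k + 1) → A) {lam mu : YoungDiagram}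
    (hmu : mu ≤ lam) :
    skewEval x lam.transpose mu.transpose =
      ∑ nu ∈ (subdiagrams lam).filter fun nu => mu ≤ nu ∧ HStrip nu.transpose lam.transpose,
        skewEval (fun i => x i.castSucc) nu.transpose mu.transpose *
          x (Fin.last k) ^ (lam.card - nu.card) := by
  rw [skewEval_succ x (YoungDiagram.transpose_le_iff.2 hmu), Finset.sum_filter,
    sum_subdiagrams_transpose, Finset.sum_filter]
  simp only [YoungDiagram.transpose_le_iff, card_transpose]

/-- The same induction with vertical strips, which are the horizontal strips of the conjugate
tableaux. -/
theorem jacobiTrudi_mul_eSeries {f : A⟦X⟧} (hf : constantCoeff f = 1) {k : ℕ} (x : Fin k → A)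
    (lam : YoungDiagram) :
    jacobiTrudi (f * eSeries x) lam =
      ∑ mu ∈ subdiagrams lam, skewEval x lam.transpose mu.transpose * jacobiTrudi f mu := by
  classical
  induction k generalizing lam with
  | zero =>
    rw [Finset.sum_eq_single lam]
    · simp [eSeries, skewEval_zero]
    · intro mu hmu hne
      rw [skewEval_zero x (YoungDiagram.transpose_le_iff.2 (mem_subdiagrams.1 hmu)),
        if_neg (by rwa [YoungDiagram.transpose_eq_iff]), zero_mul]
    · simp [mem_subdiagrams]
  | succ k ih =>
    rw [eSeries_succ, ← mul_assoc, jacobiTrudi_vStrip _ (by simp [hf])]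
    simp only [ih]
    rw [sum_sum_strip (fun nu => HStrip nu.transpose lam.transpose) lam _ _
      (fun nu mu => skewEval _ nu.transpose mu.transpose)]
    refine Finset.sum_congr rfl fun mu hmu => ?_
    rw [skewEval_transpose_succ x (mem_subdiagrams.1 hmu)]

variable {k : ℕ} (x : Fin k → A)

/-- The Jacobi–Trudi identity. -/
theorem jacobiTrudi_hSeries (lam : YoungDiagram) :
    jacobiTrudi (hSeries x) lam = skewEval x lam ⊥ := by
  classical
  rw [← one_mul (hSeries x), jacobiTrudi_mul_hSeries (by simp)]
  simp [jacobiTrudi_one, mem_subdiagrams]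

/-- The dual Jacobi–Trudi identity. -/
theorem jacobiTrudi_eSeries (lam : YoungDiagram) :
    jacobiTrudi (eSeries x) lam = skewEval x lam.transpose ⊥ := by
  classical
  rw [← one_mul (eSeries x), jacobiTrudi_mul_eSeries (by simp)]
  simp [jacobiTrudi_one, mem_subdiagrams, transpose_bot]

/-- The doubly Schur polynomial evaluated at finitely many elements of a ring. -/
def doublyEval (lam : YoungDiagram) : A :=
  ∑ mu ∈ subdiagrams lam, skewEval x mu ⊥ * skewEval x lam.transpose mu.transpose

/-- Multiplying by the elementary series contributes the conjugate skew factors, and the complete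
series left over contributes `S_mu` by Jacobi–Trudi. This is the source of the determinant formula.
-/
theorem jacobiTrudi_hSeries_mul_eSeries (lam : YoungDiagram) :
    jacobiTrudi (hSeries x * eSeries x) lam = doublyEval x lam := by
  rw [jacobiTrudi_mul_eSeries (by simp), doublyEval]
  exact Finset.sum_congr rfl fun mu _ => by rw [jacobiTrudi_hSeries, mul_comm]

/-- Doubly Schur polynomials are invariant under conjugation of the partition. -/
theorem jacobiTrudi_hSeries_mul_eSeries_transpose (lam : YoungDiagram) :
    jacobiTrudi (hSeries x * eSeries x) lam.transpose =
      jacobiTrudi (hSeries x * eSeries x) lam := by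
  -- Expanding the same product in the other order, complete factors last, exchanges the roles of
  -- `S_mu` and the conjugate skew factor; this amounts to conjugating `lam`.
  rw [jacobiTrudi_hSeries_mul_eSeries x lam, mul_comm, jacobiTrudi_mul_hSeries (by simp),
    sum_subdiagrams_transpose, doublyEval]
  refine Finset.sum_congr rfl fun mu _ => ?_
  rw [jacobiTrudi_eSeries, YoungDiagram.transpose_transpose, mul_comm]

/-! ### Cauchy identities, graded by the size of the partition -/

/-- The generating series, by the size of the partitions, of the products `F_lam G_lam`. -/
def cauchySeries (F G : YoungDiagram → A) : A⟦X⟧ :=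
  mk fun n => ∑ lam ∈ partitionsOf n, F lam * G lam

open Classical in
/-- A Pieri rule for `F` and the branching of `G` give a recursion for the sum of the products. -/
theorem cauchySeries_strip (P : YoungDiagram → YoungDiagram → Prop)
    (hP : ∀ nu lam, P nu lam → nu ≤ lam)
    {f : A⟦X⟧} {F G G' : YoungDiagram → A} (y : A)
    (hF : ∀ nu m, ∑ lam ∈ (partitionsOf (nu.card + m)).filter (P nu), F lam = coeff m f * F nu)
    (hG : ∀ lam, G' lam =
      ∑ nu ∈ (subdiagrams lam).filter (P · lam), y ^ (lam.card - nu.card) * G nu) :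
    cauchySeries F G' = cauchySeries F G * rescale y f := by
  ext n
  rw [coeff_mul]
  simp only [cauchySeries, coeff_mk, coeff_rescale, hG, Finset.mul_sum]
  have h1 (q : ℕ × ℕ) (hq : q ∈ Finset.HasAntidiagonal.antidiagonal n) :
      (∑ lam ∈ partitionsOf q.1, F lam * G lam) * (y ^ q.2 * coeff q.2 f) =
      ∑ nu ∈ partitionsOf q.1, ∑ lam ∈ (partitionsOf n).filter (P nu),
        F lam * (y ^ (lam.card - nu.card) * G nu) := by
    rw [Finset.sum_mul]
    refine Finset.sum_congr rfl fun nu hnu => ?_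
    rw [mem_partitionsOf] at hnu
    have hq' := Finset.HasAntidiagonal.mem_antidiagonal.1 hq
    have h2 := hF nu q.2
    rw [hnu, hq'] at h2
    rw [show F nu * G nu * (y ^ q.2 * coeff q.2 f) = coeff q.2 f * F nu * (y ^ q.2 * G nu) by ring,
      ← h2, Finset.sum_mul]
    refine Finset.sum_congr rfl fun lam hlam => ?_
    rw [Finset.mem_filter, mem_partitionsOf] at hlam
    rw [hlam.1, hnu, ← hq', Nat.add_sub_cancel_left]
  rw [Finset.sum_congr rfl h1, Finset.sum_sigma', Finset.sum_sigma', Finset.sum_sigma']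
  symm
  -- Both sides sum over strips `nu`, `lam` with `lam` of size `n`; the splitting of `n` is
  -- recovered from the size of `nu`.
  refine Finset.sum_bij' (fun z _ => ⟨z.2, z.1.2⟩)
    (fun z _ => ⟨⟨(z.2.card, n - z.2.card), z.2⟩, z.1⟩) ?_ ?_ ?_ ?_ ?_
  · rintro ⟨⟨q, nu⟩, lam⟩ hz
    simp only [Finset.mem_sigma, Finset.mem_filter, mem_partitionsOf, mem_subdiagrams] at hz ⊢
    exact ⟨hz.2.1, hP _ _ hz.2.2, hz.2.2⟩
  · rintro ⟨lam, nu⟩ hz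
    simp only [Finset.mem_sigma, Finset.mem_filter, mem_partitionsOf, mem_subdiagrams,
      Finset.HasAntidiagonal.mem_antidiagonal] at hz ⊢
    refine ⟨⟨?_, trivial⟩, hz.1, hz.2.2⟩
    have : nu.card ≤ lam.card := Finset.card_le_card (YoungDiagram.cells_subset_iff.2 hz.2.1)
    omega
  · rintro ⟨⟨⟨q1, q2⟩, nu⟩, lam⟩ hz
    simp only [Finset.mem_sigma, Finset.mem_filter, mem_partitionsOf,
      Finset.HasAntidiagonal.mem_antidiagonal] at hz
    obtain ⟨⟨h1, rfl⟩, -⟩ := hz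
    have : n - nu.card = q2 := by omega
    rw [this]
  · rintro ⟨lam, nu⟩ _
    rfl
  · rintro ⟨⟨q, nu⟩, lam⟩ _
    rfl

theorem cauchySeries_one {F : YoungDiagram → A} (hF : F ⊥ = 1) :
    cauchySeries F (jacobiTrudi 1) = 1 := by
  classical
  ext n
  simp only [cauchySeries, coeff_mk, jacobiTrudi_one, coeff_one, mul_ite, mul_one, mul_zero,
    Finset.sum_ite_eq', mem_partitionsOf, hF]
  have : (⊥ : YoungDiagram).card = 0 := rfl
  simp only [this, eq_comm]

/-- Each variable adjoined on the right branches along horizontal strips, which Pieri's rule on the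
left sums up to one factor `f(x_i t)`. -/
theorem cauchySeries_mul_hSeries {f g : A⟦X⟧} (hf : constantCoeff f = 1)
    (hg : constantCoeff g = 1) :
    cauchySeries (jacobiTrudi f) (jacobiTrudi (g * hSeries x)) =
      cauchySeries (jacobiTrudi f) (jacobiTrudi g) * ∏ i, rescale (x i) f := by
  classical
  induction k with
  | zero => simp [hSeries]
  | succ k ih =>
    rw [hSeries_succ, ← mul_assoc, Fin.prod_univ_castSucc, ← mul_assoc, ← ih]
    exact cauchySeries_strip HStrip (fun _ _ h => h.1) _ (sum_jacobiTrudi_hStrip hf)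
      (jacobiTrudi_mul_geomSeries (by simp [hg]) _)

/-- Branching is now along vertical strips; the invariance `hf'` converts Pieri's rule for
horizontal strips into the one needed. -/
theorem cauchySeries_mul_eSeries {f g : A⟦X⟧} (hf : constantCoeff f = 1)
    (hf' : ∀ lam : YoungDiagram, jacobiTrudi f lam.transpose = jacobiTrudi f lam)
    (hg : constantCoeff g = 1) :
    cauchySeries (jacobiTrudi f) (jacobiTrudi (g * eSeries x)) =
      cauchySeries (jacobiTrudi f) (jacobiTrudi g) * ∏ i, rescale (x i) f := by
  classical
  induction k with
  | zero => simp [eSeries]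
  | succ k ih =>
    rw [eSeries_succ, ← mul_assoc, Fin.prod_univ_castSucc, ← mul_assoc, ← ih]
    refine cauchySeries_strip (fun nu lam => HStrip nu.transpose lam.transpose)
      (fun _ _ h => YoungDiagram.transpose_le_iff.1 h.1) _ (fun nu m => ?_)
      (jacobiTrudi_vStrip _ (by simp [hg]))
    rw [← hf' nu, ← sum_jacobiTrudi_hStrip hf, card_transpose]
    refine Finset.sum_bij' (fun lam _ => lam.transpose) (fun lam _ => lam.transpose) ?_ ?_ ?_ ?_ ?_
    · intro lam hlam
      simpa [mem_partitionsOf, card_transpose] using hlam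
    · intro lam hlam
      simpa [mem_partitionsOf, card_transpose] using hlam
    · simp
    · simp
    · intro lam _
      exact (hf' lam).symm

end Series

/-! ### Hook Schur polynomials and the coefficients of `H(t) E(t)` -/

section Hooks

open PowerSeries Matrix

variable {A : Type*} [CommRing A]

theorem mem_hook {a b i j : ℕ} : (i, j) ∈ hook a b ↔ i ≤ b ∧ j < a ∧ (i = 0 ∨ j = 0) := by
  rw [← YoungDiagram.mem_cells]
  simp [hook, and_assoc]

theorem transpose_hook (a b : ℕ) : (hook (a + 1) b).transpose = hook (b + 1) a := by
  apply SetLike.ext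
  rintro ⟨i, j⟩
  rw [YoungDiagram.mem_transpose, Prod.swap_prod_mk, mem_hook, mem_hook]
  omega

theorem rowLen_hook_zero (a b : ℕ) : (hook a b).rowLen 0 = a := by
  have h (j : ℕ) : j < (hook a b).rowLen 0 ↔ j < a := by
    rw [← YoungDiagram.mem_iff_lt_rowLen, mem_hook]
    omega
  exact le_antisymm (le_of_not_gt fun h' => lt_irrefl _ ((h _).1 h'))
    (le_of_not_gt fun h' => lt_irrefl _ ((h _).2 h'))

theorem rowLen_hook_succ (a b i : ℕ) :
    (hook (a + 1) b).rowLen (i + 1) = if i < b then 1 else 0 := by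
  have h (j : ℕ) : j < (hook (a + 1) b).rowLen (i + 1) ↔ i < b ∧ j < 1 := by
    rw [← YoungDiagram.mem_iff_lt_rowLen, mem_hook]
    omega
  have h0 := h 0
  have h1 := h 1
  split_ifs <;> omega

theorem colLen_hook_le (a b : ℕ) : (hook a b).colLen 0 ≤ b + 1 := by
  by_contra h
  have := YoungDiagram.mem_iff_lt_colLen.2 (not_le.1 h)
  rw [mem_hook] at this
  omega

theorem card_hook (a b : ℕ) : (hook (a + 1) b).card = a + 1 + b := by
  rw [card_eq_sum_rowLen (colLen_hook_le _ _), Fin.sum_univ_succ]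
  simp [rowLen_hook_zero, rowLen_hook_succ]

theorem jacobiTrudi_hook_zero {f : A⟦X⟧} (hf : constantCoeff f = 1) (n : ℕ) :
    jacobiTrudi f (hook n 0) = coeff n f := by
  rw [← jtVec_rowVec hf (colLen_hook_le n 0)]
  simp [jtVec, rowVec, rowLen_hook_zero]

-- A horizontal strip added to a column lies in the first row, except possibly for one cell at the
-- foot of the column. With the size prescribed, that cell decides between the two hooks.
open Classical in
theorem partitionsOf_filter_hStrip_column (a c : ℕ) :
    (partitionsOf ((hook 1 c).card + (a + 1))).filter (fun lam => HStrip (hook 1 c) lam) =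
      {hook (a + 1) (c + 1), hook (a + 2) c} := by
  ext lam
  have hcard := card_hook 0 c
  rw [zero_add] at hcard
  simp only [Finset.mem_filter, mem_partitionsOf, Finset.mem_insert, Finset.mem_singleton, hcard,
    hStrip_iff_rowLen]
  have hr := rowLen_hook_succ 0 c
  rw [zero_add] at hr
  constructor
  · rintro ⟨h1, h2, h3⟩
    obtain ⟨a', ha'⟩ : ∃ a', lam.rowLen 0 = a' + 1 := by
      have := h2 0
      rw [rowLen_hook_zero] at this
      exact ⟨_, (Nat.sub_add_cancel this).symm⟩
    have hlast : lam.rowLen (c + 1) ≤ 1 := by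
      refine (h3 c).trans ?_
      cases c with
      | zero => rw [rowLen_hook_zero]
      | succ c => rw [hr]; split_ifs <;> omega
    -- `lam.rowLen (c + 1)` is 0 or 1 and records whether the foot cell is present.
    have hlam : lam = hook (a' + 1) (c + lam.rowLen (c + 1)) := by
      refine ext_rowLen fun i => ?_
      cases i with
      | zero => rw [rowLen_hook_zero, ha']
      | succ i =>
        rw [rowLen_hook_succ]
        have h2i := h2 (i + 1)
        have h3i := h3 i
        rw [hr] at h2i
        rcases lt_trichotomy i c with h | rfl | h
        · rw [if_pos (by omega)]
          rw [if_pos h] at h2i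
          refine le_antisymm (h3i.trans ?_) h2i
          cases i with
          | zero => rw [rowLen_hook_zero]
          | succ i => rw [hr]; split_ifs <;> omega
        · split_ifs <;> omega
        · rw [if_neg (by omega)]
          obtain ⟨i', rfl⟩ := Nat.exists_eq_succ_of_ne_zero (by omega : i ≠ 0)
          rw [Nat.succ_eq_add_one, hr, if_neg (by omega)] at h3i
          exact Nat.le_zero.1 h3i
    have hc := card_hook a' (c + lam.rowLen (c + 1))
    rw [← hlam, h1] at hc
    rcases Nat.le_one_iff_eq_zero_or_eq_one.1 hlast with h0 | h0 <;> rw [h0] at hlam hc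
    · right
      rw [hlam]
      congr 1
      omega
    · left
      rw [hlam]
      congr 1
      omega
  · rintro (rfl | rfl)
    · refine ⟨by rw [card_hook]; omega, fun i => ?_, fun i => ?_⟩
      · cases i with
        | zero => simp [rowLen_hook_zero]
        | succ i => rw [hr, rowLen_hook_succ]; split_ifs <;> omega
      · rw [rowLen_hook_succ]
        cases i with
        | zero => rw [rowLen_hook_zero]; split_ifs <;> omega
        | succ i => rw [hr]; split_ifs <;> omega
    · refine ⟨by rw [card_hook]; omega, fun i => ?_, fun i => ?_⟩
      · cases i with
        | zero => simp [rowLen_hook_zero]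
        | succ i => rw [hr, rowLen_hook_succ]
      · rw [rowLen_hook_succ]
        cases i with
        | zero => rw [rowLen_hook_zero]; split_ifs <;> omega
        | succ i => rw [hr]; split_ifs <;> omega

variable {k : ℕ} (x : Fin k → A)

theorem skewEval_column (c : ℕ) : skewEval x (hook 1 c) ⊥ = coeff (c + 1) (eSeries x) := by
  rw [← jacobiTrudi_hook_zero (constantCoeff_eSeries x), jacobiTrudi_eSeries, ← zero_add 1,
    ← transpose_hook 0 c, YoungDiagram.transpose_transpose]

/-- The product of a complete and an elementary symmetric polynomial is a sum of two hook Schur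
polynomials. -/
theorem coeff_hSeries_mul_coeff_eSeries (a c : ℕ) :
    coeff (a + 1) (hSeries x) * coeff (c + 1) (eSeries x) =
      skewEval x (hook (a + 1) (c + 1)) ⊥ + skewEval x (hook (a + 2) c) ⊥ := by
  classical
  rw [← skewEval_column, ← jacobiTrudi_hSeries, ← sum_jacobiTrudi_hStrip (by simp),
    partitionsOf_filter_hStrip_column, Finset.sum_pair]
  · simp only [jacobiTrudi_hSeries]
  · intro h
    have := congrArg (fun lam : YoungDiagram => lam.rowLen 0) h
    simp [rowLen_hook_zero] at this

/-- Each hook `(a, 1^b)` occurs twice in the convolution: in `h_a e_b` and in `h_{a-1} e_{b+1}`. The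
end terms, with an index zero, supply one hook each. -/
theorem coeff_hSeries_mul_eSeries_succ (n : ℕ) :
    coeff (n + 1) (hSeries x * eSeries x) =
      2 * ∑ p ∈ (Finset.HasAntidiagonal.antidiagonal (n + 1)).filter fun p => 1 ≤ p.1,
        skewEval x (hook p.1 p.2) ⊥ := by
  have h1 : ∑ p ∈ (Finset.HasAntidiagonal.antidiagonal (n + 1)).filter fun p => 1 ≤ p.1,
        skewEval x (hook p.1 p.2) ⊥ =
      ∑ p ∈ Finset.HasAntidiagonal.antidiagonal n, skewEval x (hook (p.1 + 1) p.2) ⊥ := by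
    rw [Finset.sum_filter, Finset.Nat.sum_antidiagonal_succ]
    simp
  have h2 : ∑ p ∈ Finset.HasAntidiagonal.antidiagonal (n + 1),
        (if 1 ≤ p.2 then skewEval x (hook (p.1 + 1) (p.2 - 1)) ⊥ else 0) =
      ∑ p ∈ Finset.HasAntidiagonal.antidiagonal n, skewEval x (hook (p.1 + 1) p.2) ⊥ := by
    rw [Finset.Nat.sum_antidiagonal_succ']
    simp
  rw [two_mul]
  nth_rw 2 [h1]
  rw [← h2, Finset.sum_filter, ← Finset.sum_add_distrib, coeff_mul]
  refine Finset.sum_congr rfl fun p hp => ?_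
  obtain ⟨a, b⟩ := p
  have hab : a + b = n + 1 := Finset.HasAntidiagonal.mem_antidiagonal.1 hp
  rcases a with _ | a <;> rcases b with _ | b
  · omega
  · simp [skewEval_column]
  · simp [← jacobiTrudi_hSeries, jacobiTrudi_hook_zero]
  · simp [coeff_hSeries_mul_coeff_eSeries]

end Hooks

/-! ### Skew Schur functions in finitely many variables as evaluations -/

section Evaluation

variable {R : Type*} [CommRing R] {lam mu : YoungDiagram}

theorem SkewTableau.weight_X {σ : Type*} [LinearOrder σ] (T : SkewTableau lam mu σ) :
    T.weight (fun i => (MvPowerSeries.X i : MvPowerSeries σ R)) =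
      MvPowerSeries.monomial T.content 1 := by
  simp only [SkewTableau.weight, SkewTableau.content, MvPowerSeries.X]
  rw [MvPowerSeries.prod_monomial, Finset.prod_const_one]

/-- In finitely many variables, a skew Schur function is the sum of the monomials of the
tableaux. -/
theorem skewSchur_eq_skewEval (k : ℕ) :
    skewSchur R (Fin k) lam mu = skewEval (fun i => MvPowerSeries.X i) lam mu := by
  classical
  ext d
  rw [skewEval, map_sum]
  simp only [SkewTableau.weight_X, MvPowerSeries.coeff_monomial]
  rw [Finset.sum_boole, ← Fintype.card_subtype]
  simp only [MvPowerSeries.coeff_apply, skewSchur, Nat.card_eq_fintype_card, eq_comm]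

theorem schur_eq_skewEval (k : ℕ) :
    schur R (Fin k) lam = skewEval (fun i => MvPowerSeries.X i) lam ⊥ :=
  skewSchur_eq_skewEval k

theorem doublySchur_eq_doublyEval (k : ℕ) :
    doublySchur R (Fin k) lam = doublyEval (fun i => MvPowerSeries.X i) lam := by
  simp only [doublySchur, doublyEval, schur_eq_skewEval, skewSchur_eq_skewEval]

theorem map_skewEval {A B : Type*} [CommRing A] [CommRing B] (g : A →+* B) {k : ℕ} (x : Fin k → A) :
    g (skewEval x lam mu) = skewEval (fun i => g (x i)) lam mu := by
  simp [skewEval, SkewTableau.weight, map_sum, map_prod]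

theorem map_doublyEval {A B : Type*} [CommRing A] [CommRing B] (g : A →+* B) {k : ℕ}
    (x : Fin k → A) : g (doublyEval x lam) = doublyEval (fun i => g (x i)) lam := by
  simp [doublyEval, map_skewEval, map_sum]

theorem twoK_eq_zcoeff (k : ℕ) (m : ℤ) :
    twoK R (Fin k) m = zcoeff (hSeries (fun i => (MvPowerSeries.X i : MvPowerSeries (Fin k) R)) *
      eSeries (fun i => MvPowerSeries.X i)) m := by
  rw [twoK, zcoeff]
  split_ifs with h h0
  · rfl
  · subst h0
    simp
  · obtain ⟨n, rfl⟩ : ∃ n : ℕ, m = (n + 1 : ℕ) := ⟨m.toNat - 1, by omega⟩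
    rw [Int.toNat_natCast, coeff_hSeries_mul_eSeries_succ, hookSum]
    simp only [schur_eq_skewEval]

/-- The determinant formula in finitely many variables. -/
theorem doublySchur_fin_eq_det (k : ℕ) (lam : YoungDiagram) {N : ℕ} (hN : lam.colLen 0 ≤ N) :
    doublySchur R (Fin k) lam = Matrix.det (Matrix.of fun i j : Fin N =>
      twoK R (Fin k) ((lam.rowLen i : ℤ) - (i : ℤ) + (j : ℤ))) := by
  rw [doublySchur_eq_doublyEval, ← jacobiTrudi_hSeries_mul_eSeries, ← jtVec_rowVec (by simp) hN]
  simp only [jtVec, rowVec, twoK_eq_zcoeff]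

end Evaluation

/-! ### Reduction from arbitrary alphabets to finite ones -/

section Restriction

variable {R : Type*} [CommRing R] {lam mu : YoungDiagram} {σ τ : Type*} [LinearOrder σ]
  [LinearOrder τ]

/-- Renaming the letters of a tableau along an order embedding. -/
def SkewTableau.map (e : σ ↪o τ) (T : SkewTableau lam mu σ) : SkewTableau lam mu τ where
  entry c := e (T.entry c)
  row_weak _ _ h h' := e.monotone (T.row_weak _ _ h h')
  col_strict _ _ h h' := e.strictMono (T.col_strict _ _ h h')

theorem SkewTableau.content_map (e : σ ↪o τ) (T : SkewTableau lam mu σ) :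
    (T.map e).content = T.content.embDomain e.toEmbedding := by
  simp only [content, Finsupp.embDomain_eq_mapDomain]
  rw [Finsupp.mapDomain_finsetSum]
  simp only [Finsupp.mapDomain_single]
  rfl

theorem SkewTableau.mem_range_of_content_eq {e : σ ↪o τ} {T : SkewTableau lam mu τ} {d : σ →₀ ℕ}
    (h : T.content = d.embDomain e.toEmbedding) (c) : T.entry c ∈ Set.range e := by
  by_contra hc
  have h0 : T.content (T.entry c) = 0 := by
    rw [h, Finsupp.embDomain_of_notMem_range _ _ _ hc]
  rw [content, Finsupp.finsetSum_apply, Finset.sum_eq_zero_iff] at h0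
  simpa using h0 c (Finset.mem_univ c)

theorem SkewTableau.exists_map_eq {e : σ ↪o τ} {T : SkewTableau lam mu τ} {d : σ →₀ ℕ}
    (h : T.content = d.embDomain e.toEmbedding) :
    ∃ T' : SkewTableau lam mu σ, T'.content = d ∧ T'.map e = T := by
  choose g hg using T.mem_range_of_content_eq h
  let T' : SkewTableau lam mu σ :=
    { entry := g
      row_weak := fun c c' h1 h2 => by
        rw [← e.le_iff_le, hg, hg]
        exact T.row_weak _ _ h1 h2
      col_strict := fun c c' h1 h2 => by
        rw [← e.lt_iff_lt, hg, hg]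
        exact T.col_strict _ _ h1 h2 }
  have hT' : T'.map e = T := entry_injective (funext hg)
  refine ⟨T', ?_, hT'⟩
  apply Finsupp.embDomain_injective e.toEmbedding
  rw [← content_map, hT', h]

/-- Setting the variables outside the range of an order embedding to zero. -/
theorem killCompl_skewSchur (e : σ ↪o τ) :
    MvPowerSeries.killCompl e.toEmbedding (skewSchur R τ lam mu) = skewSchur R σ lam mu := by
  ext d
  rw [MvPowerSeries.coeff_killCompl]
  simp only [MvPowerSeries.coeff_apply, skewSchur]
  congr 1
  symm
  refine Nat.card_congr (Equiv.ofBijective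
    (fun T => ⟨T.1.map e, by rw [SkewTableau.content_map, T.2]⟩) ⟨?_, ?_⟩)
  · rintro ⟨T, hT⟩ ⟨T', hT'⟩ h
    refine Subtype.ext (SkewTableau.entry_injective (funext fun c => e.injective ?_))
    exact congrFun (congrArg SkewTableau.entry (Subtype.ext_iff.1 h)) c
  · rintro ⟨T, hT⟩
    obtain ⟨T', h1, h2⟩ := SkewTableau.exists_map_eq hT
    exact ⟨⟨T', h1⟩, Subtype.ext h2⟩

theorem killCompl_doublySchur (e : σ ↪o τ) :
    MvPowerSeries.killCompl e.toEmbedding (doublySchur R τ lam) = doublySchur R σ lam := by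
  simp only [doublySchur, schur, map_sum, map_mul, killCompl_skewSchur]

theorem killCompl_twoK (e : σ ↪o τ) (m : ℤ) :
    MvPowerSeries.killCompl e.toEmbedding (twoK R τ m) = twoK R σ m := by
  rw [twoK, twoK]
  split_ifs
  · exact map_zero _
  · exact map_one _
  · simp only [hookSum, schur, map_sum, map_mul, killCompl_skewSchur, map_ofNat]

/-- Power series agree if they agree in every finite set of variables. -/
theorem eq_of_forall_killCompl_eq {f g : MvPowerSeries τ R}
    (h : ∀ (k : ℕ) (e : Fin k ↪o τ), MvPowerSeries.killCompl e.toEmbedding f =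
      MvPowerSeries.killCompl e.toEmbedding g) : f = g := by
  ext d
  -- One coefficient involves only the variables in the support of its exponent, listed here in
  -- increasing order.
  let e := d.support.orderEmbOfFin rfl
  have hd : d ∈ Set.range (Finsupp.embDomain (M := ℕ) e.toEmbedding) := by
    rw [Finsupp.mem_range_embDomain_iff]
    intro i hi
    have : Set.range e = d.support := Finset.range_orderEmbOfFin _ _
    exact this.ge hi
  obtain ⟨d', hd'⟩ := hd
  rw [← hd', ← MvPowerSeries.coeff_killCompl, ← MvPowerSeries.coeff_killCompl, h]

/-- Killing variables is an algebra homomorphism that carries `DS_lam` and the determinant entries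
to those of the smaller alphabet, so the finite case suffices. -/
theorem doublySchur_eq_det (lam : YoungDiagram) {N : ℕ} (hN : lam.colLen 0 ≤ N) :
    doublySchur R τ lam = Matrix.det (Matrix.of fun i j : Fin N =>
      twoK R τ ((lam.rowLen i : ℤ) - (i : ℤ) + (j : ℤ))) := by
  refine eq_of_forall_killCompl_eq fun k e => ?_
  rw [killCompl_doublySchur, doublySchur_fin_eq_det k lam hN, AlgHom.map_det]
  congr 1
  ext1 i j
  exact (killCompl_twoK e _).symm

end Restriction

/-! ### Grading by degree in the first family of variables -/

section Grading

variable {R : Type*} [CommRing R] {a b : ℕ}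

/-- The total degree of an exponent vector in the first family of variables. -/
def xDegree (d : Fin a ⊕ Fin b →₀ ℕ) : ℕ := ∑ i, d (Sum.inl i)

theorem xDegree_add (d d' : Fin a ⊕ Fin b →₀ ℕ) : xDegree (d + d') = xDegree d + xDegree d' := by
  simp [xDegree, Finset.sum_add_distrib]

theorem xDegree_single_inl (i : Fin a) : xDegree (b := b) (Finsupp.single (Sum.inl i) 1) = 1 := by
  simp [xDegree, Finsupp.single_apply]

theorem xDegree_single_inr (j : Fin b) : xDegree (a := a) (Finsupp.single (Sum.inr j) 1) = 0 := by
  simp [xDegree]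

/-- The component of degree `n` in the first family of variables. -/
def xComponent (n : ℕ) (f : MvPowerSeries (Fin a ⊕ Fin b) R) : MvPowerSeries (Fin a ⊕ Fin b) R :=
  fun d => if xDegree d = n then f d else 0

theorem coeff_xComponent (n : ℕ) (f : MvPowerSeries (Fin a ⊕ Fin b) R)
    (d : Fin a ⊕ Fin b →₀ ℕ) : MvPowerSeries.coeff d (xComponent n f) =
      if xDegree d = n then MvPowerSeries.coeff d f else 0 := rfl

/-- The substitution `x_i ↦ x_i t`, which records the decomposition by degree in the first family
of variables. -/
def xGrading :
    MvPowerSeries (Fin a ⊕ Fin b) R →+* PowerSeries (MvPowerSeries (Fin a ⊕ Fin b) R) where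
  toFun f := PowerSeries.mk fun n => xComponent n f
  map_zero' := by
    ext n d
    simp [coeff_xComponent]
  map_add' f g := by
    ext n d
    simp only [PowerSeries.coeff_mk, map_add, coeff_xComponent]
    split_ifs <;> simp
  map_one' := by
    classical
    ext n d
    simp only [PowerSeries.coeff_mk, coeff_xComponent, MvPowerSeries.coeff_one,
      PowerSeries.coeff_one]
    by_cases hd : d = 0
    · subst hd
      have h0 : xDegree (0 : Fin a ⊕ Fin b →₀ ℕ) = 0 := by simp [xDegree]
      by_cases hn : n = 0
      · simp [hn, h0]
      · simp [hn, h0, Ne.symm hn]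
    · by_cases hn : n = 0 <;> simp [hn, hd, MvPowerSeries.coeff_one]
  map_mul' f g := by
    classical
    ext n d
    simp only [PowerSeries.coeff_mk, coeff_xComponent, PowerSeries.coeff_mul, map_sum,
      MvPowerSeries.coeff_mul]
    rw [Finset.sum_comm]
    by_cases hn : xDegree d = n
    · rw [if_pos hn]
      refine Finset.sum_congr rfl fun q hq => ?_
      -- A pair of exponents contributes only to the pair of its own degrees.
      rw [Finset.sum_eq_single (xDegree q.1, xDegree q.2)]
      · simp
      · intro p _ hp
        by_cases h1 : xDegree q.1 = p.1
        · rw [if_neg (fun h2 : xDegree q.2 = p.2 => hp (Prod.ext h1.symm h2.symm)), mul_zero]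
        · rw [if_neg h1, zero_mul]
      · intro hp
        refine absurd (Finset.HasAntidiagonal.mem_antidiagonal.2 ?_) hp
        rw [← xDegree_add, Finset.HasAntidiagonal.mem_antidiagonal.1 hq, hn]
    · rw [if_neg hn]
      symm
      refine Finset.sum_eq_zero fun q hq => Finset.sum_eq_zero fun p hp => ?_
      by_cases h1 : xDegree q.1 = p.1
      · rw [if_neg (fun h2 : xDegree q.2 = p.2 => hn ?_), mul_zero]
        rw [← Finset.HasAntidiagonal.mem_antidiagonal.1 hq, xDegree_add, h1, h2,
          Finset.HasAntidiagonal.mem_antidiagonal.1 hp]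
      · rw [if_neg h1, zero_mul]

theorem coeff_coeff_xGrading (f : MvPowerSeries (Fin a ⊕ Fin b) R) (d : Fin a ⊕ Fin b →₀ ℕ) :
    MvPowerSeries.coeff d (PowerSeries.coeff (xDegree d) (xGrading f)) =
      MvPowerSeries.coeff d f := by
  simp [xGrading, coeff_xComponent]

theorem xGrading_xVar (i : Fin a) :
    xGrading (xVar R a b i) = PowerSeries.X * PowerSeries.C (xVar R a b i) := by
  classical
  ext n d
  simp only [xGrading, RingHom.coe_mk, MonoidHom.coe_mk, OneHom.coe_mk, PowerSeries.coeff_mk,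
    coeff_xComponent, xVar, MvPowerSeries.coeff_X, PowerSeries.coeff_mul_C, PowerSeries.coeff_X]
  by_cases hd : d = Finsupp.single (Sum.inl i) 1
  · subst hd
    rw [xDegree_single_inl]
    by_cases hn : n = 1
    · simp [hn]
    · simp [hn, Ne.symm hn]
  · by_cases hn : n = 1 <;> simp [hn, hd, MvPowerSeries.coeff_X]

theorem xGrading_yVar (j : Fin b) :
    xGrading (yVar R a b j) = PowerSeries.C (yVar R a b j) := by
  classical
  ext n d
  simp only [xGrading, RingHom.coe_mk, MonoidHom.coe_mk, OneHom.coe_mk, PowerSeries.coeff_mk,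
    coeff_xComponent, yVar, MvPowerSeries.coeff_X, PowerSeries.coeff_C]
  by_cases hd : d = Finsupp.single (Sum.inr j) 1
  · subst hd
    rw [xDegree_single_inr]
    by_cases hn : n = 0
    · simp [hn]
    · simp [hn, Ne.symm hn]
  · by_cases hn : n = 0 <;> simp [hn, hd, MvPowerSeries.coeff_X]

theorem xGrading_cauchyFactor (i : Fin a) (j : Fin b) :
    xGrading (cauchyFactor R a b i j) =
      (1 + PowerSeries.C (xVar R a b i * yVar R a b j) * PowerSeries.X) *
        geomSeries (xVar R a b i * yVar R a b j) := by
  have hxy : xGrading (xVar R a b i * yVar R a b j) =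
      PowerSeries.C (xVar R a b i * yVar R a b j) * PowerSeries.X := by
    rw [map_mul, xGrading_xVar, xGrading_yVar, map_mul]
    ring
  have hinv := MvPowerSeries.mul_invOfUnit (1 - xVar R a b i * yVar R a b j) 1
    (by simp [xVar, yVar])
  have h := congrArg xGrading hinv
  rw [map_mul, map_sub, map_one, hxy] at h
  rw [cauchyFactor, map_mul, map_add, map_one, hxy]
  congr 1
  -- The image of the inverse and the geometric series both invert `1 - x_i y_j t`.
  exact (left_inv_eq_right_inv (geomSeries_mul _) h).symm

end Grading

/-! ### Homogeneity of the polynomials and rescaling of their series -/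

section Homogeneity

variable {A : Type*} [CommRing A] {k : ℕ} {lam mu : YoungDiagram}

theorem skewEval_mul_left (t : A) (x : Fin k → A) (hmu : mu ≤ lam) :
    skewEval (fun i => t * x i) lam mu = t ^ (lam.card - mu.card) * skewEval x lam mu := by
  simp only [skewEval, SkewTableau.weight, Finset.prod_mul_distrib, Finset.mul_sum,
    Finset.prod_const, Finset.card_univ, Fintype.card_coe,
    Finset.card_sdiff_of_subset (YoungDiagram.cells_subset_iff.2 hmu)]

theorem doublyEval_mul_left (t : A) (x : Fin k → A) (lam : YoungDiagram) :
    doublyEval (fun i => t * x i) lam = t ^ lam.card * doublyEval x lam := by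
  rw [doublyEval, doublyEval, Finset.mul_sum]
  refine Finset.sum_congr rfl fun mu hmu => ?_
  rw [mem_subdiagrams] at hmu
  have hc : mu.card ≤ lam.card := Finset.card_le_card (YoungDiagram.cells_subset_iff.2 hmu)
  rw [skewEval_mul_left t x bot_le, skewEval_mul_left t x (YoungDiagram.transpose_le_iff.2 hmu),
    card_transpose, card_transpose, show (⊥ : YoungDiagram).card = 0 from rfl, Nat.sub_zero,
    ← Nat.add_sub_of_le hc, pow_add, Nat.add_sub_cancel_left]
  ring

theorem rescale_hSeries_mul_eSeries (x : Fin k → A) (y : A) :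
    PowerSeries.rescale y (hSeries x * eSeries x) =
      ∏ i, (1 + PowerSeries.C (x i * y) * PowerSeries.X) * geomSeries (x i * y) := by
  rw [map_mul, hSeries, eSeries, map_prod, map_prod, ← Finset.prod_mul_distrib]
  refine Finset.prod_congr rfl fun i _ => ?_
  have h1 : PowerSeries.rescale y (geomSeries (x i)) = geomSeries (x i * y) := by
    ext n
    simp [geomSeries, mul_pow, mul_comm]
  have h2 : PowerSeries.rescale y (PowerSeries.C (x i)) = PowerSeries.C (x i) := by
    ext n
    rw [PowerSeries.coeff_rescale, PowerSeries.coeff_C]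
    split_ifs with h <;> simp [h]
  rw [h1, map_add, map_one, map_mul, h2, PowerSeries.rescale_X, map_mul]
  ring

end Homogeneity

/-! ### Cauchy identities as sums over all partitions -/

section Cauchy

variable {R : Type*} [CommRing R] {a b : ℕ}

theorem inX_eq (f : MvPowerSeries (Fin a) R) :
    inX b f =
      (MvPowerSeries.rename Sum.inl : _ →ₐ[R] MvPowerSeries (Fin a ⊕ Fin b) R).toRingHom f :=
  rfl

theorem inX_doublySchur (lam : YoungDiagram) :
    inX b (doublySchur R (Fin a) lam) = doublyEval (xVar R a b) lam := by
  rw [doublySchur_eq_doublyEval, inX_eq, map_doublyEval]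
  congr 1
  funext i
  exact MvPowerSeries.rename_X _ _

theorem inY_doublySchur (lam : YoungDiagram) :
    inY a (doublySchur R (Fin b) lam) = doublyEval (yVar R a b) lam := by
  rw [doublySchur_eq_doublyEval]
  refine (map_doublyEval (MvPowerSeries.rename Sum.inr : _ →ₐ[R]
    MvPowerSeries (Fin a ⊕ Fin b) R).toRingHom _).trans ?_
  congr 1
  funext i
  exact MvPowerSeries.rename_X _ _

theorem inY_schur (lam : YoungDiagram) :
    inY a (schur R (Fin b) lam) = skewEval (yVar R a b) lam ⊥ := by
  rw [schur_eq_skewEval]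
  refine (map_skewEval (MvPowerSeries.rename Sum.inr : _ →ₐ[R]
    MvPowerSeries (Fin a ⊕ Fin b) R).toRingHom _).trans ?_
  congr 1
  funext i
  exact MvPowerSeries.rename_X _ _

/-- A sum over all partitions of terms homogeneous in the first family of variables is determined
by the sums over the partitions of each size. -/
theorem hasSum_of_xGrading [TopologicalSpace R] {u : YoungDiagram → MvPowerSeries (Fin a ⊕ Fin b) R}
    {S : MvPowerSeries (Fin a ⊕ Fin b) R}
    (hu : ∀ lam, xGrading (u lam) = PowerSeries.X ^ lam.card * PowerSeries.C (u lam))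
    (hS : ∀ n, PowerSeries.coeff n (xGrading S) = ∑ lam ∈ partitionsOf n, u lam) :
    HasSum u S := by
  refine Pi.hasSum.2 fun d => ?_
  have h : S d = ∑ lam ∈ partitionsOf (xDegree d), u lam d := by
    have := coeff_coeff_xGrading S d
    rw [hS, map_sum] at this
    exact this.symm
  rw [h]
  -- At the exponent `d` only partitions of size `xDegree d` contribute, so convergence does not
  -- depend on the topology of `R`.
  refine hasSum_sum_of_ne_finset_zero fun lam hlam => ?_
  rw [mem_partitionsOf] at hlam
  have := coeff_coeff_xGrading (u lam) d
  rw [hu, PowerSeries.coeff_X_pow_mul', PowerSeries.coeff_C] at this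
  refine this.symm.trans ?_
  split_ifs
  · omega
  · rfl
  · rfl

theorem xGrading_doublyEval_mul (lam : YoungDiagram) {v : MvPowerSeries (Fin a ⊕ Fin b) R}
    (hv : xGrading v = PowerSeries.C v) :
    xGrading (doublyEval (xVar R a b) lam * v) =
      PowerSeries.X ^ lam.card * PowerSeries.C (doublyEval (xVar R a b) lam * v) := by
  rw [map_mul, hv, map_doublyEval]
  simp only [xGrading_xVar]
  rw [doublyEval_mul_left, map_mul, map_doublyEval, mul_assoc]

theorem xGrading_prod_cauchyFactor :
    xGrading (∏ i, ∏ j, cauchyFactor R a b i j) =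
      ∏ j, PowerSeries.rescale (yVar R a b j) (hSeries (xVar R a b) * eSeries (xVar R a b)) := by
  simp only [map_prod, xGrading_cauchyFactor, rescale_hSeries_mul_eSeries]
  exact Finset.prod_comm

theorem hasSum_doublySchur_mul_schur [TopologicalSpace R] (a b : ℕ) :
    HasSum (fun lam : YoungDiagram =>
        inX b (doublySchur R (Fin a) lam) * inY a (schur R (Fin b) lam))
      (∏ i : Fin a, ∏ j : Fin b, cauchyFactor R a b i j) := by
  simp only [inX_doublySchur, inY_schur]
  refine hasSum_of_xGrading (fun lam => xGrading_doublyEval_mul lam ?_) fun n => ?_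
  · simp only [map_skewEval, xGrading_yVar]
  · have h := cauchySeries_mul_hSeries (yVar R a b) (g := 1)
      (f := hSeries (xVar R a b) * eSeries (xVar R a b)) (by simp) (by simp)
    rw [cauchySeries_one (jacobiTrudi_bot (by simp)), one_mul, one_mul,
      ← xGrading_prod_cauchyFactor] at h
    rw [← h]
    simp [cauchySeries, jacobiTrudi_hSeries_mul_eSeries, jacobiTrudi_hSeries]

theorem hasSum_doublySchur_mul_doublySchur [TopologicalSpace R] (a b : ℕ) :
    HasSum (fun lam : YoungDiagram =>
        inX b (doublySchur R (Fin a) lam) * inY a (doublySchur R (Fin b) lam))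
      (∏ i : Fin a, ∏ j : Fin b, cauchyFactor R a b i j ^ 2) := by
  simp only [inX_doublySchur, inY_doublySchur]
  refine hasSum_of_xGrading (fun lam => xGrading_doublyEval_mul lam ?_) fun n => ?_
  · simp only [map_doublyEval, xGrading_yVar]
  · have hf : PowerSeries.constantCoeff (hSeries (xVar R a b) * eSeries (xVar R a b)) = 1 := by simp
    -- The alphabet `Y` is adjoined once through `E` (here) and once through `H` (in `h'`); both
    -- contribute the same product, hence the square.
    have h := cauchySeries_mul_eSeries (yVar R a b) hf
      (jacobiTrudi_hSeries_mul_eSeries_transpose _) (constantCoeff_hSeries (yVar R a b))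
    have h' := cauchySeries_mul_hSeries (yVar R a b) (g := 1) hf (by simp)
    rw [cauchySeries_one (jacobiTrudi_bot hf), one_mul, one_mul] at h'
    rw [h', ← xGrading_prod_cauchyFactor, ← map_mul, ← sq, ← Finset.prod_pow] at h
    simp only [← Finset.prod_pow] at h
    rw [← h]
    simp [cauchySeries, jacobiTrudi_hSeries_mul_eSeries]

end Cauchy

/-! ### Standard tableaux and powers of the sum of the variables -/

section Standard

variable {lam mu nu : YoungDiagram} {k : ℕ}

/-- The multiplicity of a letter is a weight with values in additive `ℕ` written multiplicatively,
so `weight_extend` also governs contents. -/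
theorem SkewTableau.content_apply {σ : Type*} [LinearOrder σ] (T : SkewTableau lam mu σ) (i : σ) :
    T.content i =
      (T.weight fun s => Multiplicative.ofAdd (if s = i then 1 else 0)).toAdd := by
  classical
  simp [content, weight, Finsupp.finsetSum_apply, Finsupp.single_apply, ← ofAdd_sum]

theorem SkewTableau.content_extend_castSucc (hs : HStrip nu lam) (hmn : mu ≤ nu)
    (T : SkewTableau nu mu (Fin k)) (i : Fin k) :
    (T.extend hs).content i.castSucc = T.content i := by
  rw [content_apply, content_apply, weight_extend hs hmn]
  simp [(Fin.castSucc_lt_last i).ne']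

theorem SkewTableau.content_extend_last (hs : HStrip nu lam) (hmn : mu ≤ nu)
    (T : SkewTableau nu mu (Fin k)) :
    (T.extend hs).content (Fin.last k) = lam.card - nu.card := by
  rw [content_apply, weight_extend hs hmn]
  simp [weight, (Fin.castSucc_lt_last _).ne]

open Classical in
/-- The number of tableaux of straight shape in which each of the letters occurs exactly once. -/
def numLinear (n : ℕ) (lam : YoungDiagram) : ℕ :=
  ∑ T : SkewTableau lam ⊥ (Fin n), if ∀ i, T.content i = 1 then 1 else 0

-- The largest letter occurs once exactly when the strip that it fills is a single cell.
open Classical in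
theorem numLinear_succ (n : ℕ) (lam : YoungDiagram) :
    numLinear (n + 1) lam =
      ∑ nu ∈ (subdiagrams lam).filter fun nu => HStrip nu lam ∧ lam.card - nu.card = 1,
        numLinear n nu := by
  rw [numLinear, sum_skewTableau_succ bot_le _ fun nu T =>
    if lam.card - nu.card = 1 then if ∀ i, T.content i = 1 then 1 else 0 else 0]
  · simp only [bot_le, true_and]
    rw [← Finset.filter_filter, Finset.sum_filter (fun nu : YoungDiagram => lam.card - nu.card = 1)]
    refine Finset.sum_congr rfl fun nu _ => ?_
    split_ifs
    · rfl
    · simp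
  · intro nu hs hmn T
    simp only [Fin.forall_fin_succ', T.content_extend_castSucc hs hmn,
      T.content_extend_last hs hmn]
    by_cases h1 : lam.card - nu.card = 1 <;> simp [h1]

theorem numLinear_zero [DecidableEq YoungDiagram] (lam : YoungDiagram) :
    numLinear 0 lam = if ⊥ = lam then 1 else 0 := by
  have h := skewEval_zero (A := ℤ) Fin.elim0 (bot_le : ⊥ ≤ lam)
  simp only [skewEval, SkewTableau.weight] at h
  rw [numLinear]
  have hc : (∑ T : SkewTableau lam ⊥ (Fin 0), ∏ c, Fin.elim0 (T.entry c) : ℤ) =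
      (Fintype.card (SkewTableau lam ⊥ (Fin 0)) : ℤ) := by
    rw [← Finset.card_univ, ← nsmul_one, ← Finset.sum_const]
    refine Finset.sum_congr rfl fun T _ => Finset.prod_eq_one fun c _ => (T.entry c).elim0
  rw [hc] at h
  simp only [IsEmpty.forall_iff, if_true, Finset.sum_const, Finset.card_univ, smul_eq_mul, mul_one]
  exact_mod_cast h

/-- Pieri's rule for one-cell strips, applied `n` times: each step multiplies by the coefficient of
degree 1. -/
theorem sum_numLinear_mul_jacobiTrudi {A : Type*} [CommRing A] {f : PowerSeries A}
    (hf : PowerSeries.constantCoeff f = 1) (n : ℕ) :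
    ∑ lam ∈ partitionsOf n, (numLinear n lam : A) * jacobiTrudi f lam =
      PowerSeries.coeff 1 f ^ n := by
  classical
  induction n with
  | zero =>
    have h0 : (⊥ : YoungDiagram).card = 0 := rfl
    simp [numLinear_zero, mem_partitionsOf, h0, jacobiTrudi_bot hf]
  | succ n ih =>
    simp only [numLinear_succ, Nat.cast_sum, Finset.sum_mul]
    rw [Finset.sum_comm' (t' := partitionsOf n)
      (s' := fun nu => (partitionsOf (n + 1)).filter fun lam => HStrip nu lam)]
    · rw [pow_succ, ← ih, Finset.sum_mul]
      refine Finset.sum_congr rfl fun nu hnu => ?_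
      have h := sum_jacobiTrudi_hStrip hf nu 1
      rw [mem_partitionsOf.1 hnu] at h
      rw [← Finset.mul_sum, h]
      ring
    · intro lam nu
      simp only [Finset.mem_filter, mem_partitionsOf, mem_subdiagrams]
      constructor
      · rintro ⟨h1, -, h2, h3⟩
        exact ⟨⟨h1, h2⟩, by omega⟩
      · rintro ⟨⟨h1, h2⟩, h3⟩
        exact ⟨h1, h2.1, h2, by omega⟩

/-- Each letter occurring once means that the filling is bijective, and injectivity turns weakly
increasing rows into strictly increasing ones. -/
theorem numStandard_eq_numLinear (lam : YoungDiagram) :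
    numStandard lam = numLinear lam.card lam := by
  classical
  have hcells : lam.cells \ (⊥ : YoungDiagram).cells = lam.cells := by simp
  let κ : {c : ℕ × ℕ // c ∈ lam.cells \ (⊥ : YoungDiagram).cells} ≃ {c : ℕ × ℕ // c ∈ lam.cells} :=
    Equiv.subtypeEquivRight fun c => by rw [hcells]
  have hbij {e : {c : ℕ × ℕ // c ∈ lam.cells \ (⊥ : YoungDiagram).cells} → Fin lam.card} :
      (∀ i, (∑ c, Finsupp.single (e c) 1 : Fin lam.card →₀ ℕ) i = 1) ↔ Function.Bijective e := by
    rw [Function.bijective_iff_existsUnique]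
    refine forall_congr' fun i => ?_
    rw [Finsupp.finsetSum_apply]
    simp only [Finsupp.single_apply]
    rw [Finset.sum_boole, Nat.cast_id, Finset.card_eq_one, Finset.singleton_iff_unique_mem]
    simp
  have h : numLinear lam.card lam =
      Nat.card {T : SkewTableau lam ⊥ (Fin lam.card) // ∀ i, T.content i = 1} := by
    rw [numLinear, Finset.sum_boole, Nat.cast_id, Nat.card_eq_fintype_card, Fintype.card_subtype]
  rw [h, numStandard]
  refine Nat.card_congr
    { toFun := fun T => ⟨⟨T.entry ∘ κ, fun c c' h1 h2 => (T.row_strict (κ c) (κ c') h1 h2).le,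
        fun c c' h1 h2 => T.col_strict (κ c) (κ c') h1 h2⟩,
        hbij.2 (T.bijective.comp κ.bijective)⟩
      invFun := fun T => ⟨T.1.entry ∘ κ.symm, (hbij.1 T.2).comp κ.symm.bijective,
        fun c c' h1 h2 => lt_of_le_of_ne (T.1.row_weak (κ.symm c) (κ.symm c') h1 h2) fun h3 => ?_,
        fun c c' h1 h2 => T.1.col_strict (κ.symm c) (κ.symm c') h1 h2⟩
      left_inv := fun T => rfl
      right_inv := fun T => rfl }
  have h4 := κ.symm.injective ((hbij.1 T.2).injective h3)
  rw [h4] at h2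
  exact lt_irrefl _ h2

theorem coeff_one_mul_of_constantCoeff {A : Type*} [CommRing A] {f g : PowerSeries A}
    (hf : PowerSeries.constantCoeff f = 1) (hg : PowerSeries.constantCoeff g = 1) :
    PowerSeries.coeff 1 (f * g) = PowerSeries.coeff 1 f + PowerSeries.coeff 1 g := by
  rw [PowerSeries.coeff_one_mul, hf, hg, mul_one, mul_one]

theorem coeff_one_hSeries_mul_eSeries {A : Type*} [CommRing A] (x : Fin k → A) :
    PowerSeries.coeff 1 (hSeries x * eSeries x) = 2 * ∑ i, x i := by
  rw [coeff_one_mul_of_constantCoeff (by simp) (by simp), two_mul]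
  congr 1
  · induction k with
    | zero => simp [hSeries]
    | succ k ih =>
      rw [hSeries_succ, coeff_one_mul_of_constantCoeff (by simp) (by simp), ih,
        Fin.sum_univ_castSucc]
      simp [geomSeries]
  · induction k with
    | zero => simp [eSeries]
    | succ k ih =>
      rw [eSeries_succ, coeff_one_mul_of_constantCoeff (by simp) (by simp), ih,
        Fin.sum_univ_castSucc]
      simp

theorem sum_numStandard_mul_doublySchur (R : Type*) [CommRing R] (n k : ℕ) :
    ∑ lam ∈ partitionsOf n,
        (numStandard lam : MvPowerSeries (Fin k) R) * doublySchur R (Fin k) lam =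
      2 ^ n * (∑ i : Fin k, MvPowerSeries.X i) ^ n := by
  rw [← mul_pow, ← coeff_one_hSeries_mul_eSeries, ← sum_numLinear_mul_jacobiTrudi (by simp)]
  refine Finset.sum_congr rfl fun lam hlam => ?_
  rw [doublySchur_eq_doublyEval, jacobiTrudi_hSeries_mul_eSeries, numStandard_eq_numLinear,
    mem_partitionsOf.1 hlam]

end Standard

end DoublySchur

end

/-- Sums over all partitions converge in the product topology over a discrete coefficient ring:
every coefficient is a finite sum. -/
theorem theorem2p10 (R : Type*) [CommRing R] [TopologicalSpace R] [DiscreteTopology R] :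
    (∀ (σ : Type*) [LinearOrder σ] (lam : YoungDiagram) (N : ℕ), lam.colLen 0 ≤ N →
      DoublySchur.doublySchur R σ lam =
        Matrix.det (Matrix.of fun i j : Fin N =>
          DoublySchur.twoK R σ ((lam.rowLen i : ℤ) - (i : ℤ) + (j : ℤ)))) ∧
    (∀ n k : ℕ,
      ∑ lam ∈ DoublySchur.partitionsOf n,
          (DoublySchur.numStandard lam : MvPowerSeries (Fin k) R) *
            DoublySchur.doublySchur R (Fin k) lam =
        2 ^ n * (∑ i : Fin k, MvPowerSeries.X i) ^ n) ∧
    (∀ a b : ℕ,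
      HasSum (fun lam : YoungDiagram =>
          DoublySchur.inX b (DoublySchur.doublySchur R (Fin a) lam) *
            DoublySchur.inY a (DoublySchur.doublySchur R (Fin b) lam))
        (∏ i : Fin a, ∏ j : Fin b, DoublySchur.cauchyFactor R a b i j ^ 2)) ∧
    (∀ a b : ℕ,
      HasSum (fun lam : YoungDiagram =>
          DoublySchur.inX b (DoublySchur.doublySchur R (Fin a) lam) *
            DoublySchur.inY a (DoublySchur.schur R (Fin b) lam))
        (∏ i : Fin a, ∏ j : Fin b, DoublySchur.cauchyFactor R a b i j)) := by
  refine ⟨fun σ _ lam N hN => DoublySchur.doublySchur_eq_det lam hN,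
    DoublySchur.sum_numStandard_mul_doublySchur R,
    DoublySchur.hasSum_doublySchur_mul_doublySchur, DoublySchur.hasSum_doublySchur_mul_schur⟩
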